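/- Let $\mathfrak g$ be a finite-dimensional real Lie algebra whose Killing form is negative definite, let $\mathfrak t\subset\mathfrak g$ be a maximal abelian subalgebra, let $\mathfrak g^{\mathbb C}=\mathfrak g\otimes_{\mathbb R}\mathbb C$ and $\mathfrak t^{\mathbb C}$ be the complexifications, $X\mapsto\overline X$ the complex conjugation of $\mathfrak g^{\mathbb C}$ along $\mathfrak g$, and $\varkappa$ the Killing form of $\mathfrak g^{\mathbb C}$. For $\alpha\in(\mathfrak t^{\mathbb C})^*$ put $\mathfrak g^{\mathbb C}_\alpha=\{X\in\mathfrak g^{\mathbb C}: [H,X]=\alpha(H)X\ \text{for all } H\in\mathfrak t^{\mathbb C}\}$, and let $\Delta=\{\alpha\neq0:\mathfrak g^{\mathbb C}_\alpha\neq0\}$ be the root system. Let $\alpha^\sharp\in\mathfrak t^{\mathbb C}$ be the vector with $\alpha=\varkappa(\alpha^\sharp,\cdot)$ on $\mathfrak t^{\mathbb C}$, and put $\langle\alpha,\beta\rangle=\varkappa(\alpha^\sharp,\beta^\sharp)$ and $\|\alpha\|=\sqrt{\langle\alpha,\alpha\rangle}$ for $\alpha,\beta\in\Delta$ (these are real numbers).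 Fix $H_0\in\mathfrak t$ with $\alpha(H_0)\neq0$ for all $\alpha\in\Delta$, and let $\Delta_+=\{\alpha\in\Delta:\alpha(H_0)\in i\,\mathbb R_{>0}\}$ be the set of positive roots, $\Pi\subset\Delta_+$ the set of simple roots (those that are not the sum of two positive roots), $\ell(\beta)=\sum_{\alpha\in\Pi}k_\alpha$ the level of a root $\beta=\sum_{\alpha\in\Pi}k_\alpha\alpha$ ($k_\alpha\in\mathbb Z$), and $L$ the maximal level of a positive root ($L=0$ if there are no roots). A Chevalley basis of $\mathfrak g^{\mathbb C}$ is a family $(X_\alpha)_{\alpha\in\Delta}$ with $X_\alpha\in\mathfrak g^{\mathbb C}_\alpha$ for which there are real numbers $c_{\alpha,\beta}$ (the Chevalley constants) such that for all $\alpha,\beta\in\Delta$: $[X_\alpha,X_\beta]=c_{\alpha,\beta}X_{\alpha+\beta}$ if $\alpha+\beta\in\Delta$, $[X_\alpha,X_\beta]=\alpha^\sharp$ if $\alpha+\beta=0$, $[X_\alpha,X_\beta]=0$ otherwise, and $c_{-\alpha,-\beta}=-c_{\alpha,\beta}$; by convention $c_{\alpha,\beta}=0$ if $\alpha+\beta\notin\Delta$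 and $\beta\neq-\alpha$. (The symbols $c_{\alpha,-\alpha}$ carry no information.) For every $\alpha\in\Delta_+\setminus\Pi$ fix a decomposition $\alpha=\zeta_\alpha+\eta_\alpha$ with $\zeta_\alpha,\eta_\alpha\in\Delta_+$. Call a Chevalley basis $(X_\alpha)$ with constants $(c_{\alpha,\beta})$ adapted if (i) $X_{-\alpha}=-\overline{X_\alpha}$ for every $\alpha\in\Delta_+$, and (ii) $c_{\zeta_\alpha,\eta_\alpha}>0$ for every $\alpha\in\Delta_+\setminus\Pi$. Algorithm (C) computes a table of real numbers $c_{\alpha,\beta}$, $\alpha,\beta\in\Delta_+$, as follows. (C1) Put $c_{\alpha,\beta}:=0$ for all $\alpha,\beta\in\Delta_+$ with $\alpha+\beta\notin\Delta_+$. (C2)–(C4) For $\ell=2,\dots,L$ and for all $\alpha\in\Delta_+$ of level $\ell$, with $\zeta:=\zeta_\alpha$ and $\eta:=\eta_\alpha$, do (C5)–(C7). (C5) Let $p\ge0$ be the smallest integer with $\eta-(p+1)\zeta\notin\Delta$, put $q:=p-2\langle\eta,\zeta\rangle/\|\zeta\|^2$, $c_{\zeta,\eta}:=\sqrt{q(1+p)/2}\,\|\zeta\|$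 and $c_{\eta,\zeta}:=-c_{\zeta,\eta}$. (C6)–(C7) For all pairs $(\gamma,\delta)$ of positive roots with $\gamma+\delta=\alpha$ and $\gamma,\delta\notin\{\zeta,\eta\}$ put $c_{\gamma,\delta}:=\frac1{c_{\zeta,\eta}}(c_{11}c_{12}+c_{21}c_{22})$, where $$c_{11}=\begin{cases}c_{\eta,\gamma-\eta}&\gamma-\eta\in\Delta_+\\ c_{\gamma,\eta-\gamma}&\eta-\gamma\in\Delta_+\\0&\text{otherwise}\end{cases}\qquad c_{12}=\begin{cases}c_{\delta,\zeta-\delta}&\zeta-\delta\in\Delta_+\\ c_{\zeta,\delta-\zeta}&\delta-\zeta\in\Delta_+\\0&\text{otherwise}\end{cases}$$ $$c_{21}=\begin{cases}c_{\zeta-\gamma,\gamma}&\zeta-\gamma\in\Delta_+\\ c_{\gamma-\zeta,\zeta}&\gamma-\zeta\in\Delta_+\\0&\text{otherwise}\end{cases}\qquad c_{22}=\begin{cases}c_{\eta,\delta-\eta}&\delta-\eta\in\Delta_+\\ c_{\delta,\eta-\delta}&\eta-\delta\in\Delta_+\\0&\text{otherwise.}\end{cases}$$ A table on $\Delta_+\times\Delta_+$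 is extended to all pairs of roots $\alpha,\beta$ with $\beta\neq-\alpha$ by putting, for $\alpha,\beta\in\Delta_+$, $c_{-\alpha,-\beta}:=-c_{\alpha,\beta}$ and, for $\alpha\ne\beta$ in $\Delta_+$, $c_{\alpha,-\beta}:=-c_{-\alpha,\beta}:=c_{\beta-\alpha,\alpha}$ if $\beta-\alpha\in\Delta_+$, $:=c_{\alpha-\beta,\beta}$ if $\alpha-\beta\in\Delta_+$, and $:=0$ otherwise (here $-c_{-\alpha,\beta}$ is given the same value as $c_{\alpha,-\beta}$). Then: (a) There is an adapted Chevalley basis of $\mathfrak g^{\mathbb C}$. (b) Any two adapted Chevalley bases have the same Chevalley constants $c_{\alpha,\beta}$ ($\alpha,\beta\in\Delta$, $\beta\neq-\alpha$). (c) The constants of every Chevalley basis satisfy $c_{\alpha,\beta}^2=\frac{q(1+p)}2\|\alpha\|^2$ for all $\alpha,\beta\in\Delta$ with $\beta\ne-\alpha$, where $\{k\in\mathbb Z:\beta+k\alpha\in\Delta\cup\{0\}\}=\{-p,\dots,q\}$ with integers $p,q\ge0$; and $c_{\alpha,\beta}c_{\gamma,\delta}+c_{\beta,\gamma}c_{\alpha,\delta}+c_{\gamma,\alpha}c_{\beta,\delta}=0$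 for all $\alpha,\beta,\gamma,\delta\in\Delta$ with $\alpha+\beta+\gamma+\delta=0$ none of which is the negative of one of the others. (d) The loops of Algorithm (C) run over finite sets, and Algorithm (C) is correct: in whatever order the roots of each level and the pairs $(\gamma,\delta)$ are run through, and whatever values the table has initially, for every $n\le L$ the table after the iteration of level $n$ contains the Chevalley constant $c_{\alpha,\beta}$ of every adapted Chevalley basis for all $\alpha,\beta\in\Delta_+$ with $\alpha+\beta\in\Delta_+$ of level at most $n$; and the extension of the final table to all roots gives the Chevalley constants $c_{\alpha,\beta}$ for all $\alpha,\beta\in\Delta$ with $\beta\neq-\alpha$. -/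

import Mathlib

open scoped TensorProduct

noncomputable section

/-- A real Lie algebra is *compact* (in the sense used here) if its Killing form is negative
definite. -/
class IsCompactLieAlgebra (g : Type*) [LieRing g] [LieAlgebra ℝ g] : Prop where
  killingForm_neg : ∀ x : g, x ≠ 0 → killingForm ℝ g x x < 0

/-- The complexification `ℂ ⊗ g` of a real Lie algebra `g`, with Mathlib's complex Lie algebra
structure on it. -/
def Complexification (g : Type*) [LieRing g] [LieAlgebra ℝ g] : Type _ := ℂ ⊗[ℝ] g

namespace Complexification

variable (g : Type*) [LieRing g] [LieAlgebra ℝ g]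

instance instLieRing : LieRing (Complexification g) :=
  LieAlgebra.ExtendScalars.instLieRing ℝ ℂ g

instance instLieAlgebra : LieAlgebra ℂ (Complexification g) :=
  LieAlgebra.ExtendScalars.instLieAlgebra ℝ ℂ g

instance instLieAlgebraReal : LieAlgebra ℝ (Complexification g) :=
  LieAlgebra.ExtendScalars.instBaseLieAlgebra ℝ ℂ g

instance instFinite [Module.Finite ℝ g] : Module.Finite ℂ (Complexification g) :=
  inferInstanceAs (Module.Finite ℂ (ℂ ⊗[ℝ] g))

/-- Complex conjugation `z ⊗ x ↦ conj z ⊗ x` of the complexification along `g`. -/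
def conj : Complexification g →ₗ[ℝ] Complexification g :=
  LinearMap.rTensor g Complex.conjAe.toLinearMap

variable {g}

/-- The inclusion `x ↦ 1 ⊗ x` of `g` into its complexification. -/
def of : g →ₗ[ℝ] Complexification g := TensorProduct.mk ℝ ℂ g 1

theorem of_apply (x : g) : of x = (1 : ℂ) ⊗ₜ[ℝ] x := rfl

theorem of_smul (r : ℝ) (x : g) : of (r • x) = (r : ℂ) • of x := by
  change (1 : ℂ) ⊗ₜ[ℝ] (r • x) = (r : ℂ) • ((1 : ℂ) ⊗ₜ[ℝ] x)
  rw [TensorProduct.tmul_smul, TensorProduct.smul_tmul', TensorProduct.smul_tmul']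
  simp

theorem lie_of (x y : g) : ⁅of x, of y⁆ = of ⁅x, y⁆ := by
  change ((1 : ℂ) * 1) ⊗ₜ[ℝ] ⁅x, y⁆ = (1 : ℂ) ⊗ₜ[ℝ] ⁅x, y⁆
  rw [one_mul]

theorem killingForm_of [Module.Finite ℝ g] (x y : g) :
    killingForm ℂ (Complexification g) (of x) (of y) = (killingForm ℝ g x y : ℂ) := by
  have h : LieModule.traceForm ℂ (ℂ ⊗[ℝ] g) (ℂ ⊗[ℝ] g) =
      (LieModule.traceForm ℝ g g).baseChange ℂ := LieModule.traceForm_baseChange ..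
  have h2 : LieModule.traceForm ℂ (ℂ ⊗[ℝ] g) (ℂ ⊗[ℝ] g) ((1 : ℂ) ⊗ₜ[ℝ] x) ((1 : ℂ) ⊗ₜ[ℝ] y) =
      (LieModule.traceForm ℝ g g x y : ℂ) := by
    rw [h]
    simp
  exact h2

end Complexification

namespace ChevalleyBasis

section Complexification

variable {g : Type*} [LieRing g] [LieAlgebra ℝ g]

/-- The complexification of the subalgebra `t` (the complex span of `t`), as a subalgebra of the
complexification of `g`. -/
def complexify (t : LieSubalgebra ℝ g) : LieSubalgebra ℂ (Complexification g) where
  toSubmodule := Submodule.span ℂ {v | ∃ H ∈ t, v = Complexification.of H}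
  lie_mem' := by
    intro x y hx hy
    refine Submodule.span_induction₂ (p := fun x y _ _ =>
      ⁅x, y⁆ ∈ Submodule.span ℂ {v | ∃ H ∈ t, v = Complexification.of H})
      ?_ ?_ ?_ ?_ ?_ ?_ ?_ hx hy
    · rintro _ _ ⟨a, ha, rfl⟩ ⟨b, hb, rfl⟩
      exact Submodule.subset_span ⟨⁅a, b⁆, t.lie_mem ha hb, Complexification.lie_of a b⟩
    · intro y _
      simp
    · intro x _
      simp
    · intro x y z _ _ _ h1 h2
      rw [add_lie]
      exact Submodule.add_mem _ h1 h2
    · intro x y z _ _ _ h1 h2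
      rw [lie_add]
      exact Submodule.add_mem _ h1 h2
    · intro r x y _ _ h
      rw [smul_lie]
      exact Submodule.smul_mem _ _ h
    · intro r x y _ _ h
      rw [lie_smul]
      exact Submodule.smul_mem _ _ h

/-- The inclusion of `t` into its complexification. -/
def incl (t : LieSubalgebra ℝ g) (H : t) : complexify t :=
  ⟨Complexification.of (H : g), Submodule.subset_span ⟨H, H.2, rfl⟩⟩

/-- Complex linear forms on the complexification of `t`. -/
abbrev Form (t : LieSubalgebra ℝ g) : Type _ := Module.Dual ℂ (complexify t)

/-- The root space of the linear form `α`: all `X` in the complexification of `g` with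
`[H, X] = α(H) X` for every `H` in the complexification of `t`. -/
def rootSpace (t : LieSubalgebra ℝ g) (α : Form t) : Submodule ℂ (Complexification g) where
  carrier := {X | ∀ H : complexify t, ⁅(H : Complexification g), X⁆ = α H • X}
  add_mem' := by
    intro X Y hX hY H
    rw [lie_add, hX H, hY H, smul_add]
  zero_mem' := by
    intro H
    simp
  smul_mem' := by
    intro c X hX H
    rw [lie_smul, hX H, smul_comm]

/-- The root system `Δ`. -/
def roots (t : LieSubalgebra ℝ g) : Set (Form t) :=
  {α | α ≠ 0 ∧ rootSpace t α ≠ ⊥}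

/-- The positive roots with respect to `H₀ ∈ t`: the roots `α` with `α(H₀) ∈ i ℝ₊`. -/
def posRoots (t : LieSubalgebra ℝ g) (H₀ : t) : Set (Form t) :=
  {α | α ∈ roots t ∧ ∃ r : ℝ, 0 < r ∧ α (incl t H₀) = Complex.I * (r : ℂ)}

/-- The map `v ↦ κ(v, ·)` from the complexification of `t` to its dual, where `κ` is the Killing
form of the complexification of `g`. -/
def flat (t : LieSubalgebra ℝ g) : complexify t →ₗ[ℂ] Form t :=
  (killingForm ℂ (Complexification g)).domRestrict₁₂
    (complexify t).toSubmodule (complexify t).toSubmodule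

theorem flat_apply (t : LieSubalgebra ℝ g) (v H : complexify t) :
    flat t v H = killingForm ℂ (Complexification g) v H := rfl

theorem exists_re_im (t : LieSubalgebra ℝ g) (v : Complexification g) (hv : v ∈ complexify t) :
    ∃ a b : t, v = Complexification.of (a : g) + Complex.I • Complexification.of (b : g) := by
  change v ∈ Submodule.span ℂ {v | ∃ H ∈ t, v = Complexification.of H} at hv
  induction hv using Submodule.span_induction with
  | mem x hx =>
    obtain ⟨a, ha, rfl⟩ := hx
    exact ⟨⟨a, ha⟩, 0, by simp⟩
  | zero => exact ⟨0, 0, by simp⟩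
  | add x y hx hy ihx ihy =>
    obtain ⟨a, b, rfl⟩ := ihx
    obtain ⟨a', b', rfl⟩ := ihy
    refine ⟨a + a', b + b', ?_⟩
    have hca : ((a + a' : t) : g) = (a : g) + (a' : g) := rfl
    have hcb : ((b + b' : t) : g) = (b : g) + (b' : g) := rfl
    rw [hca, hcb, map_add, map_add, smul_add]
    abel
  | smul c x hx ihx =>
    obtain ⟨a, b, rfl⟩ := ihx
    refine ⟨c.re • a - c.im • b, c.im • a + c.re • b, ?_⟩
    have hca : ((c.re • a - c.im • b : t) : g) = c.re • (a : g) - c.im • (b : g) := rfl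
    have hcb : ((c.im • a + c.re • b : t) : g) = c.im • (a : g) + c.re • (b : g) := rfl
    rw [hca, hcb, map_sub, map_add]
    simp only [Complexification.of_smul]
    generalize Complexification.of (a : g) = A
    generalize Complexification.of (b : g) = B
    conv_lhs => rw [← Complex.re_add_im c]
    match_scalars
    · ring
    · linear_combination (c.im : ℂ) * Complex.I_mul_I

theorem flat_bijective [Module.Finite ℝ g] [IsCompactLieAlgebra g] (t : LieSubalgebra ℝ g) :
    Function.Bijective (flat t) := by
  have hneg : ∀ x : g, killingForm ℝ g x x = 0 → x = 0 := by
    intro x hx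
    by_contra h
    exact (IsCompactLieAlgebra.killingForm_neg x h).ne hx
  have hinj : Function.Injective (flat t) := by
    rw [injective_iff_map_eq_zero]
    intro v hv
    obtain ⟨a, b, hab⟩ := exists_re_im t v v.2
    have h1 : flat t v (incl t a) = 0 := by rw [hv]; rfl
    have h2 : flat t v (incl t b) = 0 := by rw [hv]; rfl
    simp only [flat_apply, hab, incl, map_add, map_smul, LinearMap.add_apply,
      LinearMap.smul_apply, Complexification.killingForm_of, smul_eq_mul] at h1 h2
    have h1' := congrArg Complex.re h1
    have h2' := congrArg Complex.im h2
    simp at h1' h2'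
    have ha := hneg _ h1'
    have hb := hneg _ h2'
    apply Subtype.ext
    rw [hab, ha, hb]
    simp
  have hfin : Module.Finite ℂ (complexify t).toSubmodule := inferInstance
  have hd : Module.finrank ℂ (complexify t).toSubmodule =
      Module.finrank ℂ (Module.Dual ℂ (complexify t).toSubmodule) :=
    (Subspace.dual_finrank_eq).symm
  exact ⟨hinj, (LinearMap.injective_iff_surjective_of_finrank_eq_finrank
    (V := (complexify t).toSubmodule) hd).1 hinj⟩

/-- The linear isomorphism `α ↦ α♯`, where `α♯` is the element of the complexification of `t`
with `α = κ(α♯, ·)`. -/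
def sharp [Module.Finite ℝ g] [IsCompactLieAlgebra g] (t : LieSubalgebra ℝ g) :
    Form t ≃ₗ[ℂ] complexify t :=
  (LinearEquiv.ofBijective (flat t) (flat_bijective t)).symm

/-- The inner product `⟨α, β⟩ = κ(α♯, β♯)` on linear forms; it is used for `α`, `β` in the real
span of the roots, where the value of `κ` is real. -/
def formInner [Module.Finite ℝ g] [IsCompactLieAlgebra g] (t : LieSubalgebra ℝ g)
    (α β : Form t) : ℝ :=
  (killingForm ℂ (Complexification g) (sharp t α) (sharp t β)).re

/-- `X` is a Chevalley basis of the complexification of `g` and `c` is a family of Chevalley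
constants for it. Only the values of `X` and `c` on roots matter, and the value `c α (-α)` plays
no role except for antisymmetry under negation. -/
structure IsChevalleyBasis [Module.Finite ℝ g] [IsCompactLieAlgebra g] (t : LieSubalgebra ℝ g)
    (X : Form t → Complexification g) (c : Form t → Form t → ℝ) : Prop where
  mem_rootSpace : ∀ α ∈ roots t, X α ∈ rootSpace t α
  lie_of_add_mem : ∀ α ∈ roots t, ∀ β ∈ roots t, α + β ∈ roots t →
    ⁅X α, X β⁆ = (c α β : ℂ) • X (α + β)
  lie_of_add_eq_zero : ∀ α ∈ roots t, ∀ β ∈ roots t, α + β = 0 →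
    ⁅X α, X β⁆ = (sharp t α : Complexification g)
  lie_of_add_not_mem : ∀ α ∈ roots t, ∀ β ∈ roots t, α + β ∉ roots t → α + β ≠ 0 →
    ⁅X α, X β⁆ = 0
  neg_neg : ∀ α ∈ roots t, ∀ β ∈ roots t, c (-α) (-β) = -c α β
  eq_zero : ∀ α ∈ roots t, ∀ β ∈ roots t, α + β ∉ roots t → β ≠ -α → c α β = 0

end Complexification

section Combinatorics

variable {V : Type*} [AddCommGroup V]

/-- The simple elements of a set `P` of positive roots: those that are not the sum of two
elements of `P`. -/
def simpleRoots (P : Set V) : Set V :=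
  {α | α ∈ P ∧ ¬ ∃ β ∈ P, ∃ γ ∈ P, α = β + γ}

/-- `β` has level `n`: `β` is an integral linear combination of simple roots with sum of
coefficients `n`. -/
def HasLevel (P : Set V) (β : V) (n : ℤ) : Prop :=
  ∃ k : V →₀ ℤ, (k.support : Set V) ⊆ simpleRoots P ∧
    k.sum (fun α m => m • α) = β ∧ k.sum (fun _ m => m) = n

/-- The maximal level of a positive root (`0` if there are no roots). -/
def maxLevel (P : Set V) : ℕ := sSup {n : ℕ | ∃ α ∈ P, HasLevel P α n}

/-- The `α`-string through `β` is `{β + k α | -p ≤ k ≤ q}`. -/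
def IsString (Δ : Set V) (α β : V) (p q : ℕ) : Prop :=
  ∀ k : ℤ, (β + k • α ∈ Δ ∨ β + k • α = 0) ↔ (-(p : ℤ) ≤ k ∧ k ≤ (q : ℤ))

/-- A choice of a decomposition `α = ζ α + η α` into positive roots for each non-simple positive
root `α`. -/
def IsDecomposition (P : Set V) (ζ η : V → V) : Prop :=
  ∀ α ∈ P \ simpleRoots P, ζ α ∈ P ∧ η α ∈ P ∧ α = ζ α + η α

end Combinatorics

/-! The algorithm. Its input is the root system `Δ`, the set `P` of positive roots, the inner
product `ip` on roots and the decompositions `ζ`, `η`; its state is a table `c` of real numbers. -/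

section Algorithm

open scoped Classical in
/-- The assignment `c a b := v`. -/
def assign {V : Type*} (c : V → V → ℝ) (a b : V) (v : ℝ) : V → V → ℝ :=
  fun x y => if x = a ∧ y = b then v else c x y

variable {V : Type*} [AddCommGroup V]

open scoped Classical in
/-- Step (C1): put `c α β := 0` for all positive `α`, `β` such that `α + β` is not a positive
root. -/
def stepC1 (P : Set V) (c : V → V → ℝ) : V → V → ℝ :=
  fun α β => if α ∈ P ∧ β ∈ P ∧ α + β ∉ P then 0 else c α β

/-- The smallest `p ≥ 0` such that `η - (p + 1) ζ` is not a root. -/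
def stringP (Δ : Set V) (ζ η : V) : ℕ := sInf {p : ℕ | η - (p + 1) • ζ ∉ Δ}

/-- The value assigned to `c ζ η` in step (C5). -/
def valueC5 (Δ : Set V) (ip : V → V → ℝ) (ζ η : V) : ℝ :=
  let p : ℝ := stringP Δ ζ η
  let q : ℝ := p - 2 * (ip η ζ / ip ζ ζ)
  Real.sqrt (q * (1 + p) / 2) * Real.sqrt (ip ζ ζ)

/-- Step (C5): calculate `c ζ η` and `c η ζ`. -/
def stepC5 (Δ : Set V) (ip : V → V → ℝ) (ζ η : V) (c : V → V → ℝ) : V → V → ℝ :=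
  let v := valueC5 Δ ip ζ η
  assign (assign c ζ η v) η ζ (-v)

open scoped Classical in
/-- Step (C7): calculate `c γ δ`, where `γ + δ = ζ + η`. -/
def stepC7 (P : Set V) (ζ η γ δ : V) (c : V → V → ℝ) : V → V → ℝ :=
  let c₁₁ := if γ - η ∈ P then c η (γ - η) else if η - γ ∈ P then c γ (η - γ) else 0
  let c₁₂ := if ζ - δ ∈ P then c δ (ζ - δ) else if δ - ζ ∈ P then c ζ (δ - ζ) else 0
  let c₂₁ := if ζ - γ ∈ P then c (ζ - γ) γ else if γ - ζ ∈ P then c (γ - ζ) ζ else 0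
  let c₂₂ := if δ - η ∈ P then c η (δ - η) else if η - δ ∈ P then c δ (η - δ) else 0
  assign c γ δ (1 / c ζ η * (c₁₁ * c₁₂ + c₂₁ * c₂₂))

/-- An order in which the loops (C3) and (C6) of the algorithm are run through: `rootsOfLevel ℓ`
lists the positive roots of level `ℓ`, and `pairs α` lists the pairs `(γ, δ)` of positive roots
with `γ + δ = α` and `γ, δ ∉ {ζ α, η α}`. -/
structure LoopOrder (P : Set V) (ζ η : V → V) where
  rootsOfLevel : ℕ → List V
  nodup_rootsOfLevel : ∀ ℓ, (rootsOfLevel ℓ).Nodup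
  mem_rootsOfLevel : ∀ (ℓ : ℕ) (α : V), α ∈ rootsOfLevel ℓ ↔ α ∈ P ∧ HasLevel P α ℓ
  pairs : V → List (V × V)
  nodup_pairs : ∀ α, (pairs α).Nodup
  mem_pairs : ∀ α γ δ : V, (γ, δ) ∈ pairs α ↔ γ ∈ P ∧ δ ∈ P ∧ γ + δ = α ∧
    γ ∉ ({ζ α, η α} : Set V) ∧ δ ∉ ({ζ α, η α} : Set V)

/-- Steps (C4) to (C7) for the root `α`. -/
def stepRoot (Δ P : Set V) (ip : V → V → ℝ) (ζ η : V → V) (o : LoopOrder P ζ η)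
    (c : V → V → ℝ) (α : V) : V → V → ℝ :=
  (o.pairs α).foldl (fun c γδ => stepC7 P (ζ α) (η α) γδ.1 γδ.2 c) (stepC5 Δ ip (ζ α) (η α) c)

/-- Steps (C3) to (C8) for the level `ℓ`. -/
def stepLevel (Δ P : Set V) (ip : V → V → ℝ) (ζ η : V → V) (o : LoopOrder P ζ η)
    (c : V → V → ℝ) (ℓ : ℕ) : V → V → ℝ :=
  (o.rootsOfLevel ℓ).foldl (stepRoot Δ P ip ζ η o) c

/-- The table after step (C1) and the iterations of (C2) for the levels `2, …, n`, starting from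
the (uninitialized) table `c₀`. -/
def runUpTo (Δ P : Set V) (ip : V → V → ℝ) (ζ η : V → V) (o : LoopOrder P ζ η)
    (c₀ : V → V → ℝ) (n : ℕ) : V → V → ℝ :=
  (List.range' 2 (n - 1)).foldl (stepLevel Δ P ip ζ η o) (stepC1 P c₀)

/-- The output of Algorithm (C): the levels `2, …, L` are run through, where `L` is the maximal
level. -/
def algorithmC (Δ P : Set V) (ip : V → V → ℝ) (ζ η : V → V) (o : LoopOrder P ζ η)
    (c₀ : V → V → ℝ) : V → V → ℝ :=
  runUpTo Δ P ip ζ η o c₀ (maxLevel P)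

open scoped Classical in
/-- The value of `c α (-β)` for positive `α ≠ β` in terms of the constants of positive roots. -/
def mixedValue (P : Set V) (c : V → V → ℝ) (α β : V) : ℝ :=
  if β - α ∈ P then c (β - α) α else if α - β ∈ P then c (α - β) β else 0

open scoped Classical in
/-- The extension of a table of constants from positive roots to all roots, by
`c α (-β) = -c (-α) β = mixedValue P c α β` and `c (-α) (-β) = -c α β` for positive `α`, `β`. -/
def extendTable (P : Set V) (c : V → V → ℝ) (α β : V) : ℝ :=
  if α ∈ P then
    if β ∈ P then c α β else mixedValue P c α (-β)
  else
    if β ∈ P then -mixedValue P c (-α) β else -c (-α) (-β)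

end Algorithm

section Adapted

variable {g : Type*} [LieRing g] [LieAlgebra ℝ g] [Module.Finite ℝ g] [IsCompactLieAlgebra g]

/-- `X` is a Chevalley basis with Chevalley constants `c` such that `X (-α) = -conj (X α)` for all
positive roots `α` and `c (ζ α) (η α) > 0` for all non-simple positive roots `α`. -/
structure IsAdapted (t : LieSubalgebra ℝ g) (H₀ : t) (ζ η : Form t → Form t)
    (X : Form t → Complexification g) (c : Form t → Form t → ℝ) : Prop
    extends IsChevalleyBasis t X c where
  neg_eq : ∀ α ∈ posRoots t H₀, X (-α) = -Complexification.conj g (X α)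
  pos : ∀ α ∈ posRoots t H₀ \ simpleRoots (posRoots t H₀), 0 < c (ζ α) (η α)

end Adapted

end ChevalleyBasis

end

/-! Negative definiteness makes `-κ(X, conj X)` a positive definite Hermitian form on the
complexification. Hence the Killing form there is nondegenerate, the complexification of `t` is a
Cartan subalgebra, and roots are imaginary on `t`, so that `conj` exchanges the root spaces of `α`
and `-α`.

Normalize root vectors by `[X_α, X_{-α}] = α♯`. The Jacobi identity then gives `N α β = N β γ` if `α
+ β + γ = 0` (`IsWeylBasis.cyclic`) and the four-root relation (`IsWeylBasis.isStructureTable`). The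
representation theory of `sl₂` on the `α`-string through `β` gives `N α β * N (-α) (-β) = -q(1+p)/2
* ‖α‖²` (`IsWeylBasis.mul_neg_neg`). For a Chevalley basis this is the formula for the squares, so
that `c ζ η` is known once it is required to be positive.

If `γ + δ = ζ + η`, the four-root relation for `γ, δ, -ζ, -η` expresses `c γ δ * c ζ η` by constants
of mixed sign. Cyclicity rewrites these as constants of positive roots whose sum is one of `γ, δ, ζ,
η`, hence of lower level. This is step (C7), and correctness follows by induction on the level
(`IsStructureTable.runUpTo_agreesOn`). Uniqueness is a consequence: the output of the algorithm does
not depend on the adapted basis.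

For existence, take unit vectors for the Hermitian form in the positive root spaces and put `X_{-α}
= -conj X_α`. Level by level, the phases are changed so that the constants of the chosen
decompositions become positive (`exists_unit_rootVectors`). The recursion behind (C7) then shows
that all constants are real (`IsStructureTable.conj_eq_of_decomposition`), and applying `conj` to
brackets gives `c (-α) (-β) = -c α β`. -/

noncomputable section
namespace ChevalleyBasis

/-! ### Levels of positive roots -/

section Levels

variable {V : Type*} [AddCommGroup V] {P : Set V}

theorem HasLevel.add {α β : V} {m n : ℤ} (hα : HasLevel P α m) (hβ : HasLevel P β n) :
    HasLevel P (α + β) (m + n) := by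
  classical
  obtain ⟨k, hk, rfl, rfl⟩ := hα
  obtain ⟨l, hl, rfl, rfl⟩ := hβ
  refine ⟨k + l, ?_, ?_, ?_⟩
  · refine (Finset.coe_subset.2 Finsupp.support_add).trans ?_
    rw [Finset.coe_union]
    exact Set.union_subset hk hl
  · exact Finsupp.sum_add_index' (fun _ => zero_smul _ _) (fun _ _ _ => add_smul _ _ _)
  · exact Finsupp.sum_add_index' (fun _ => rfl) (fun _ _ _ => rfl)

theorem hasLevel_one {α : V} (hα : α ∈ simpleRoots P) : HasLevel P α 1 := by
  classical
  refine ⟨Finsupp.single α 1, ?_, ?_, ?_⟩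
  · intro x hx
    have := Finsupp.support_single_subset hx
    rw [Finset.mem_singleton] at this
    rwa [this]
  · rw [Finsupp.sum_single_index (h := fun α m => m • α) (zero_smul ℤ α), one_smul]
  · rw [Finsupp.sum_single_index rfl]

theorem HasLevel.unique (hli : LinearIndepOn ℤ id (simpleRoots P)) {α : V} {m n : ℤ}
    (hm : HasLevel P α m) (hn : HasLevel P α n) : m = n := by
  obtain ⟨k, hk, hkα, rfl⟩ := hm
  obtain ⟨l, hl, hlα, rfl⟩ := hn
  have h : k = l := by
    refine linearIndepOn_iffₛ.1 hli k ?_ l ?_ ?_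
    · exact (Finsupp.mem_supported _ _).2 hk
    · exact (Finsupp.mem_supported _ _).2 hl
    · rw [Finsupp.linearCombination_apply, Finsupp.linearCombination_apply]
      exact hkα.trans hlα.symm
  rw [h]

/-- Induction on the value of `r`, which drops in passing from a sum to its summands and is
well-founded on the finite set `P`. -/
theorem exists_hasLevel (hfin : P.Finite) (r : V →+ ℝ) (hr : ∀ α ∈ P, 0 < r α) :
    ∀ α ∈ P, ∃ n : ℕ, 1 ≤ n ∧ HasLevel P α n := by
  intro α hα
  have hwf : P.WellFoundedOn (fun a b => r a < r b) :=
    Set.Finite.wellFoundedOn (r := fun a b => r a < r b) hfin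
  refine hwf.induction (P := fun α => ∃ n : ℕ, 1 ≤ n ∧ HasLevel P α n) hα ?_
  intro α hα ih
  by_cases hs : α ∈ simpleRoots P
  · exact ⟨1, le_rfl, by exact_mod_cast hasLevel_one hs⟩
  · have : ∃ β ∈ P, ∃ γ ∈ P, α = β + γ := by
      by_contra h
      exact hs ⟨hα, h⟩
    obtain ⟨β, hβ, γ, hγ, rfl⟩ := this
    obtain ⟨m, hm, hm'⟩ := ih β hβ (by rw [map_add]; linarith [hr γ hγ])
    obtain ⟨n, hn, hn'⟩ := ih γ hγ (by rw [map_add]; linarith [hr β hβ])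
    exact ⟨m + n, by omega, by exact_mod_cast hm'.add hn'⟩

/-- A function giving the level of every element of `P`. -/
structure IsLevel (P : Set V) (lev : V → ℕ) : Prop where
  hasLevel_iff : ∀ α ∈ P, ∀ n : ℤ, HasLevel P α n ↔ n = lev α
  one_le : ∀ α ∈ P, 1 ≤ lev α
  map_add : ∀ α ∈ P, ∀ β ∈ P, α + β ∈ P → lev (α + β) = lev α + lev β
  map_simple : ∀ α ∈ simpleRoots P, lev α = 1
  le_maxLevel : ∀ α ∈ P, lev α ≤ maxLevel P

theorem exists_isLevel (hfin : P.Finite) (r : V →+ ℝ) (hr : ∀ α ∈ P, 0 < r α)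
    (hli : LinearIndepOn ℤ id (simpleRoots P)) : ∃ lev : V → ℕ, IsLevel P lev := by
  classical
  have h := exists_hasLevel hfin r hr
  choose! lev h1 hlev using h
  refine ⟨lev, ?_, h1, ?_, ?_, ?_⟩
  · intro α hα n
    exact ⟨fun hn => hn.unique hli (hlev α hα), fun hn => hn ▸ hlev α hα⟩
  · intro α hα β hβ hαβ
    exact_mod_cast (hlev _ hαβ).unique hli ((hlev α hα).add (hlev β hβ))
  · intro α hα
    exact_mod_cast (hlev α hα.1).unique hli (hasLevel_one hα)
  · intro α hα
    refine le_csSup ?_ ⟨α, hα, hlev α hα⟩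
    refine (Set.Finite.subset (hfin.image lev) ?_).bddAbove
    rintro n ⟨β, hβ, hn⟩
    exact ⟨β, hβ, by exact_mod_cast (hlev β hβ).unique hli hn⟩

theorem nonempty_loopOrder (hfin : P.Finite)
    (ζ η : V → V) : Nonempty (LoopOrder P ζ η) := by
  classical
  have h1 : ∀ ℓ : ℕ, {α | α ∈ P ∧ HasLevel P α ℓ}.Finite :=
    fun ℓ => hfin.subset fun α hα => hα.1
  have h2 : ∀ α : V, {x : V × V | x.1 ∈ P ∧ x.2 ∈ P ∧ x.1 + x.2 = α ∧
      x.1 ∉ ({ζ α, η α} : Set V) ∧ x.2 ∉ ({ζ α, η α} : Set V)}.Finite :=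
    fun α => (hfin.prod hfin).subset fun x hx => ⟨hx.1, hx.2.1⟩
  exact ⟨⟨fun ℓ => (h1 ℓ).toFinset.toList, fun ℓ => Finset.nodup_toList _, by simp,
    fun α => (h2 α).toFinset.toList, fun α => Finset.nodup_toList _, by simp⟩⟩

end Levels

/-! ### Correctness of the algorithm for abstract tables -/

section Assign

variable {V : Type*} {c : V → V → ℝ}

/-- Assigning a correct value never spoils a correct entry, even one that it overwrites. For this
reason the order of the loops does not matter. -/
theorem assign_eq {T : V → V → ℝ} {a b x y : V} {v : ℝ} (hv : v = c a b) (h : T x y = c x y) :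
    assign T a b v x y = c x y := by
  unfold assign
  split_ifs with h'
  · rw [hv, h'.1, h'.2]
  · exact h

theorem assign_self {T : V → V → ℝ} {a b : V} {v : ℝ} : assign T a b v a b = v :=
  if_pos ⟨rfl, rfl⟩

end Assign

section Tables

variable {V : Type*} [AddCommGroup V]

/-- `P` is a system of positive elements of the finite set `Δ`. -/
structure IsPositiveSystem (Δ P : Set V) : Prop where
  finite : P.Finite
  neg_mem : ∀ α ∈ Δ, -α ∈ Δ
  subset : P ⊆ Δ
  mem_or : ∀ α ∈ Δ, α ∈ P ∨ -α ∈ P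
  neg_notMem : ∀ α ∈ P, -α ∉ P
  add_mem : ∀ α ∈ P, ∀ β ∈ P, α + β ∈ Δ → α + β ∈ P
  add_self_notMem : ∀ α ∈ Δ, α + α ∉ Δ

/-- The identities satisfied by the structure constants with respect to root vectors normalized by
`[X_α, X_{-α}] = α♯`. -/
structure IsStructureTable {K : Type*} [CommRing K] (Δ : Set V) (N : V → V → K) : Prop where
  eq_zero : ∀ α ∈ Δ, ∀ β ∈ Δ, α + β ∉ Δ → β ≠ -α → N α β = 0
  skew : ∀ α ∈ Δ, ∀ β ∈ Δ, β ≠ -α → N β α = -N α β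
  cyclic : ∀ α ∈ Δ, ∀ β ∈ Δ, ∀ γ ∈ Δ, α + β + γ = 0 → N α β = N β γ
  four : ∀ α ∈ Δ, ∀ β ∈ Δ, ∀ γ ∈ Δ, ∀ δ ∈ Δ, α + β + γ + δ = 0 →
    α ≠ -β → α ≠ -γ → α ≠ -δ → β ≠ -γ → β ≠ -δ → γ ≠ -δ →
    N α β * N γ δ + N β γ * N α δ + N γ α * N β δ = 0

variable {Δ P : Set V}

/-- A table `T` that agrees with `c` at all pairs of positive roots whose sum is in `W`. -/
def AgreesOn (P : Set V) (c : V → V → ℝ) (W : Set V) (T : V → V → ℝ) : Prop :=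
  ∀ α ∈ P, ∀ β ∈ P, α + β ∈ W → T α β = c α β

namespace IsPositiveSystem

theorem sub_mem_cases (hP : IsPositiveSystem Δ P) {α β : V} (h : α - β ∈ Δ) :
    α - β ∈ P ∨ β - α ∈ P := by
  rcases hP.mem_or _ h with h | h
  · exact Or.inl h
  · exact Or.inr (by rwa [neg_sub] at h)

theorem sub_notMem (hP : IsPositiveSystem Δ P) {α β : V} (h : α - β ∈ P) : β - α ∉ P := by
  have := hP.neg_notMem _ h
  rwa [neg_sub] at this

theorem sub_notMem_of_notMem (hP : IsPositiveSystem Δ P) {α β : V} (h : α - β ∉ P)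
    (h' : β - α ∉ P) : α + -β ∉ Δ := by
  rw [← sub_eq_add_neg]
  intro h''
  exact (hP.sub_mem_cases h'').elim h h'

theorem ne_neg (hP : IsPositiveSystem Δ P) {α β : V} (hα : α ∈ P) (hβ : β ∈ P) : α ≠ -β := by
  rintro rfl
  exact hP.neg_notMem β hβ hα

theorem ne_of_add_mem (hP : IsPositiveSystem Δ P) {α β : V} (hα : α ∈ P) (h : α + β ∈ P) :
    α ≠ β := by
  rintro rfl
  exact hP.add_self_notMem α (hP.subset hα) (hP.subset h)

end IsPositiveSystem

namespace IsStructureTable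

/-- The four-root relation for two decompositions `γ + δ = ζ + η` of a positive root. -/
theorem four_of_add_eq {K : Type*} [CommRing K] {N : V → V → K} (hP : IsPositiveSystem Δ P)
    (hN : IsStructureTable Δ N) {γ δ ζ η : V} (hγ : γ ∈ P) (hδ : δ ∈ P) (hζ : ζ ∈ P) (hη : η ∈ P)
    (h : γ + δ = ζ + η) (hγζ : γ ≠ ζ) (hγη : γ ≠ η) (hδζ : δ ≠ ζ) (hδη : δ ≠ η) :
    N γ δ * N (-ζ) (-η) + N δ (-ζ) * N γ (-η) + N (-ζ) γ * N δ (-η) = 0 := by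
  have hs := hP.subset
  refine hN.four γ (hs hγ) δ (hs hδ) (-ζ) (hP.neg_mem _ (hs hζ)) (-η) (hP.neg_mem _ (hs hη))
    ?_ (hP.ne_neg hγ hδ) ?_ ?_ ?_ ?_ ?_
  · rw [h]; abel
  · rwa [neg_neg]
  · rwa [neg_neg]
  · rwa [neg_neg]
  · rwa [neg_neg]
  · rw [neg_neg]; exact (hP.ne_neg hη hζ).symm

variable {c : V → V → ℝ}

/-- Cyclicity for the triple `β - α, α, -β`, or for `α, -β, -(α - β)` followed by a change of all
signs. -/
theorem mixed (hP : IsPositiveSystem Δ P) (hc : IsStructureTable Δ c)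
    (hneg : ∀ α ∈ Δ, ∀ β ∈ Δ, c (-α) (-β) = -c α β) {α β : V} (hα : α ∈ P) (hβ : β ∈ P)
    (hne : α ≠ β) : c α (-β) = mixedValue P c α β := by
  have hs := hP.subset
  have hαβ : -β ≠ -α := fun h => hne (neg_injective h).symm
  unfold mixedValue
  split_ifs with h1 h2
  · rw [hc.cyclic (β - α) (hs h1) α (hs hα) (-β) (hP.neg_mem _ (hs hβ)) (by abel)]
  · rw [hc.cyclic α (hs hα) (-β) (hP.neg_mem _ (hs hβ)) (-(α - β)) (hP.neg_mem _ (hs h2)) (by abel),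
      hneg β (hs hβ) _ (hs h2), hc.skew (α - β) (hs h2) β (hs hβ) (hP.ne_neg hβ h2), neg_neg]
  · exact hc.eq_zero α (hs hα) _ (hP.neg_mem _ (hs hβ)) (hP.sub_notMem_of_notMem h2 h1) hαβ

theorem extendTable_eq (hP : IsPositiveSystem Δ P) (hc : IsStructureTable Δ c)
    (hneg : ∀ α ∈ Δ, ∀ β ∈ Δ, c (-α) (-β) = -c α β) {T : V → V → ℝ}
    (hT : ∀ α ∈ P, ∀ β ∈ P, T α β = c α β) :
    ∀ α ∈ Δ, ∀ β ∈ Δ, β ≠ -α → extendTable P T α β = c α β := by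
  have hmixed : ∀ α ∈ P, ∀ β ∈ P, mixedValue P T α β = mixedValue P c α β := by
    intro α hα β hβ
    unfold mixedValue
    split_ifs with h1 h2
    · exact hT _ h1 _ hα
    · exact hT _ h2 _ hβ
    · rfl
  have hmem : ∀ α ∈ Δ, α ∉ P → -α ∈ P := fun α hα h => (hP.mem_or α hα).resolve_left h
  intro α hα β hβ hne
  unfold extendTable
  split_ifs with h1 h2 h2
  · exact hT _ h1 _ h2
  · have h3 := hmem β hβ h2
    rw [hmixed _ h1 _ h3, ← mixed hP hc hneg h1 h3 fun h => hne (by rw [h, neg_neg]), neg_neg]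
  · have h3 := hmem α hα h1
    rw [hmixed _ h3 _ h2, ← mixed hP hc hneg h3 h2 fun h => hne h.symm, ← neg_neg (c (-α) (-β)),
      ← hneg _ (hP.neg_mem _ hα) _ (hP.neg_mem _ hβ), neg_neg, neg_neg, neg_neg]
  · rw [hT _ (hmem α hα h1) _ (hmem β hβ h2), hneg α hα β hβ, neg_neg]

/-- The four factors in (C7) are `-c γ (-η)`, `-c δ (-ζ)`, `c γ (-ζ)` and `-c δ (-η)`, so the
assigned value is the solution of the four-root relation for `c γ δ`. Every entry read has sum `γ`,
`δ`, `ζ` or `η`, except for `c ζ η` itself; this is why correctness on `W` suffices. -/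
theorem stepC7_value (hP : IsPositiveSystem Δ P) (hc : IsStructureTable Δ c)
    (hneg : ∀ α ∈ Δ, ∀ β ∈ Δ, c (-α) (-β) = -c α β) {W : Set V} {T : V → V → ℝ}
    (hT : AgreesOn P c W T) {γ δ ζ η : V} (hγ : γ ∈ P) (hδ : δ ∈ P) (hζ : ζ ∈ P) (hη : η ∈ P)
    (hγW : γ ∈ W) (hδW : δ ∈ W) (hζW : ζ ∈ W) (hηW : η ∈ W)
    (h : γ + δ = ζ + η) (hγζ : γ ≠ ζ) (hγη : γ ≠ η) (hδζ : δ ≠ ζ) (hδη : δ ≠ η)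
    (hne : c ζ η ≠ 0) (hTζ : T ζ η = c ζ η) :
    stepC7 P ζ η γ δ T = assign T γ δ (c γ δ) := by
  classical
  have hs := hP.subset
  have e1 : ∀ x ∈ P, ∀ y ∈ P, x ∈ W → y ∈ W → x ≠ y →
      (if x - y ∈ P then T y (x - y) else if y - x ∈ P then T x (y - x) else 0) = -c x (-y) := by
    intro x hx y hy hxW hyW hxy
    rw [mixed hP hc hneg hx hy hxy]
    unfold mixedValue
    split_ifs with h1 h2 h3
    · exact absurd h2 (hP.sub_notMem h1)
    · rw [hT y hy _ h1 (by rwa [add_sub_cancel]),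
        hc.skew _ (hs h1) y (hs hy) (hP.ne_neg hy h1)]
    · rw [hT x hx _ h3 (by rwa [add_sub_cancel]), hc.skew _ (hs h3) x (hs hx) (hP.ne_neg hx h3)]
    · rw [neg_zero]
  have e2 : ∀ x ∈ P, ∀ y ∈ P, x ∈ W → y ∈ W → x ≠ y →
      (if y - x ∈ P then T (y - x) x else if x - y ∈ P then T (x - y) y else 0) = c x (-y) := by
    intro x hx y hy hxW hyW hxy
    rw [mixed hP hc hneg hx hy hxy]
    unfold mixedValue
    split_ifs with h1 h2
    · exact hT _ h1 _ hx (by rwa [sub_add_cancel])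
    · exact hT _ h2 _ hy (by rwa [sub_add_cancel])
    · rfl
  -- The same factor as in `e1` with the two tests interchanged, which is harmless because they
  -- exclude each other.
  have e3 : ∀ x ∈ P, ∀ y ∈ P, x ∈ W → y ∈ W → x ≠ y →
      (if y - x ∈ P then T x (y - x) else if x - y ∈ P then T y (x - y) else 0) = -c x (-y) := by
    intro x hx y hy hxW hyW hxy
    rw [← e1 x hx y hy hxW hyW hxy]
    split_ifs with h1 h2
    · exact absurd h2 (hP.sub_notMem h1)
    all_goals rfl
  unfold stepC7
  simp only []
  rw [e1 γ hγ η hη hγW hηW hγη, e3 δ hδ ζ hζ hδW hζW hδζ, e2 γ hγ ζ hζ hγW hζW hγζ,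
    e1 δ hδ η hη hδW hηW hδη, hTζ]
  congr 1
  have h4 := four_of_add_eq hP hc hγ hδ hζ hη h hγζ hγη hδζ hδη
  rw [hneg ζ (hs hζ) η (hs hη), hc.skew γ (hs hγ) (-ζ) (hP.neg_mem _ (hs hζ))
    (fun h => hγζ (neg_injective h).symm)] at h4
  field_simp
  linear_combination h4

theorem stepRoot_agreesOn (hP : IsPositiveSystem Δ P) (hc : IsStructureTable Δ c)
    (hneg : ∀ α ∈ Δ, ∀ β ∈ Δ, c (-α) (-β) = -c α β) {ζ η : V → V} {ip : V → V → ℝ}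
    (o : LoopOrder P ζ η) {W : Set V} {T : V → V → ℝ} (hT : AgreesOn P c W T) {α : V}
    (hζ : ζ α ∈ P) (hη : η α ∈ P) (hα : α = ζ α + η α) (hαP : α ∈ P)
    (hval : valueC5 Δ ip (ζ α) (η α) = c (ζ α) (η α)) (hne : c (ζ α) (η α) ≠ 0)
    (hW : ∀ γ ∈ P, ∀ δ ∈ P, γ + δ = α → γ ∈ W) :
    AgreesOn P c (insert α W) (stepRoot Δ P ip ζ η o T α) := by
  have hs := hP.subset
  have hζη : ζ α ≠ η α := hP.ne_of_add_mem hζ (hα ▸ hαP)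
  have hskew := hc.skew _ (hs hζ) _ (hs hη) (hP.ne_neg hη hζ)
  have h5 : ∀ x y, T x y = c x y → stepC5 Δ ip (ζ α) (η α) T x y = c x y := by
    intro x y h
    exact assign_eq (by rw [hval, hskew]) (assign_eq hval h)
  have h5ηζ : stepC5 Δ ip (ζ α) (η α) T (η α) (ζ α) = c (η α) (ζ α) := by
    unfold stepC5
    rw [assign_self, hval, hskew]
  have h5ζη : stepC5 Δ ip (ζ α) (η α) T (ζ α) (η α) = c (ζ α) (η α) := by
    refine assign_eq (by rw [hval, hskew]) ?_
    rw [assign_self, hval]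
  -- Invariant of the inner loop: an entry that is already correct, or whose pair is still to be
  -- treated, is correct at the end.
  have hfold : ∀ (l : List (V × V)) (T' : V → V → ℝ),
      (∀ p ∈ l, p.1 ∈ P ∧ p.2 ∈ P ∧ p.1 + p.2 = α ∧ p.1 ∉ ({ζ α, η α} : Set V) ∧
        p.2 ∉ ({ζ α, η α} : Set V)) →
      AgreesOn P c W T' → T' (ζ α) (η α) = c (ζ α) (η α) →
      ∀ x y, (T' x y = c x y ∨ (x, y) ∈ l) →
        l.foldl (fun c γδ => stepC7 P (ζ α) (η α) γδ.1 γδ.2 c) T' x y = c x y := by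
    intro l
    induction l with
    | nil =>
      intro T' _ _ _ x y hxy
      simpa using hxy
    | cons p l ih =>
      intro T' hl hT' hTζ x y hxy
      obtain ⟨h1, h2, h3, h4, h4'⟩ := hl p (List.mem_cons_self ..)
      simp only [Set.mem_insert_iff, Set.mem_singleton_iff, not_or] at h4 h4'
      rw [List.foldl_cons, stepC7_value hP hc hneg hT' h1 h2 hζ hη (hW _ h1 _ h2 h3)
        (hW _ h2 _ h1 (by rw [add_comm, h3])) (hW _ hζ _ hη hα.symm)
        (hW _ hη _ hζ (by rw [add_comm, ← hα])) (h3.trans hα) h4.1 h4.2 h4'.1 h4'.2 hne hTζ]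
      refine ih _ (fun q hq => hl q (List.mem_cons_of_mem _ hq)) ?_ (assign_eq rfl hTζ) x y ?_
      · exact fun a ha b hb hab => assign_eq rfl (hT' a ha b hb hab)
      · rcases hxy with hxy | hxy
        · exact Or.inl (assign_eq rfl hxy)
        · rcases List.mem_cons.1 hxy with rfl | hxy
          · exact Or.inl assign_self
          · exact Or.inr hxy
  intro x hx y hy hxy
  refine hfold _ _ (fun p hp => (o.mem_pairs α p.1 p.2).1 hp) ?_ h5ζη x y ?_
  · exact fun a ha b hb hab => h5 a b (hT a ha b hb hab)
  -- A decomposition of `α` is `(ζ, η)` or `(η, ζ)`, treated in (C5), or else avoids both roots in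
  -- both places and so occurs in the list of pairs.
  · rcases hxy with hxy | hxy
    · by_cases h1 : x = ζ α
      · have h2 : y = η α := by
          rw [h1] at hxy
          exact add_left_cancel (hxy.trans hα)
        exact Or.inl (by rw [h1, h2, h5ζη])
      by_cases h2 : x = η α
      · have h3 : y = ζ α := by
          replace hxy : η α + y = η α + ζ α := by
            rw [← h2, hxy, h2, add_comm, ← hα]
          exact add_left_cancel hxy
        exact Or.inl (by rw [h2, h3, h5ηζ])
      have h3 : y ≠ η α := by
        rintro h
        rw [h] at hxy
        exact h1 (add_right_cancel (hxy.trans hα))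
      have h4 : y ≠ ζ α := by
        rintro h
        rw [h] at hxy
        exact h2 (add_right_cancel (hxy.trans (hα.trans (add_comm _ _))))
      exact Or.inr ((o.mem_pairs α x y).2 ⟨hx, hy, hxy, by simp [h1, h2], by simp [h3, h4]⟩)
    · exact Or.inl (h5 _ _ (hT x hx y hy hxy))

theorem stepLevel_agreesOn (hP : IsPositiveSystem Δ P) (hc : IsStructureTable Δ c)
    (hneg : ∀ α ∈ Δ, ∀ β ∈ Δ, c (-α) (-β) = -c α β) {ζ η : V → V} {ip : V → V → ℝ}
    (hζη : IsDecomposition P ζ η)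
    (hval : ∀ α ∈ P \ simpleRoots P, valueC5 Δ ip (ζ α) (η α) = c (ζ α) (η α))
    (hne : ∀ α ∈ P \ simpleRoots P, c (ζ α) (η α) ≠ 0)
    (o : LoopOrder P ζ η) (l : List V) :
    ∀ {W : Set V} {T : V → V → ℝ}, AgreesOn P c W T →
    (∀ α ∈ l, α ∈ P \ simpleRoots P ∧ ∀ γ ∈ P, ∀ δ ∈ P, γ + δ = α → γ ∈ W) →
    AgreesOn P c (W ∪ {α | α ∈ l}) (l.foldl (stepRoot Δ P ip ζ η o) T) := by
  induction l with
  | nil =>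
    intro W T hT _
    simpa using hT
  | cons α l ih =>
    intro W T hT hl
    obtain ⟨h1, h2⟩ := hl α (List.mem_cons_self ..)
    obtain ⟨h3, h4, h5⟩ := hζη α h1
    have h6 := ih (stepRoot_agreesOn hP hc hneg o hT h3 h4 h5 h1.1 (hval α h1) (hne α h1) h2)
      (fun β hβ => ⟨(hl β (List.mem_cons_of_mem _ hβ)).1, fun γ hγ δ hδ h =>
        Set.mem_insert_of_mem _ ((hl β (List.mem_cons_of_mem _ hβ)).2 γ hγ δ hδ h)⟩)
    rw [List.foldl_cons]
    intro x hx y hy hxy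
    refine h6 x hx y hy ?_
    rcases hxy with hxy | hxy
    · exact Or.inl (Set.mem_insert_of_mem _ hxy)
    · rcases List.mem_cons.1 hxy with hxy | hxy
      · exact Or.inl (by rw [hxy]; exact Set.mem_insert _ _)
      · exact Or.inr hxy

/-- The set of controlled sums contains everything outside `P`, so the zeros from (C1) are part of
the invariant. Both summands of a root of level `n + 1` have level at most `n`, so roots of the same
level do not interfere. -/
theorem runUpTo_agreesOn (hP : IsPositiveSystem Δ P) (hc : IsStructureTable Δ c)
    (hneg : ∀ α ∈ Δ, ∀ β ∈ Δ, c (-α) (-β) = -c α β) {ζ η : V → V} {ip : V → V → ℝ}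
    (hζη : IsDecomposition P ζ η)
    (hval : ∀ α ∈ P \ simpleRoots P, valueC5 Δ ip (ζ α) (η α) = c (ζ α) (η α))
    (hne : ∀ α ∈ P \ simpleRoots P, c (ζ α) (η α) ≠ 0) {lev : V → ℕ} (hl : IsLevel P lev)
    (o : LoopOrder P ζ η) (c₀ : V → V → ℝ) (n : ℕ) :
    AgreesOn P c {α | α ∈ P → lev α ≤ n} (runUpTo Δ P ip ζ η o c₀ n) := by
  -- A sum of two positive roots that is a positive root has level at least 2, so only zeros are
  -- asserted here.
  have hstart : AgreesOn P c {α | α ∈ P → lev α ≤ 1} (stepC1 P c₀) := by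
    intro α hα β hβ hαβ
    have hnot : α + β ∉ P := by
      intro h
      have h1 := hαβ h
      rw [hl.map_add α hα β hβ h] at h1
      have := hl.one_le α hα
      have := hl.one_le β hβ
      omega
    unfold stepC1
    rw [if_pos ⟨hα, hβ, hnot⟩, hc.eq_zero α (hP.subset hα) β (hP.subset hβ)
      (fun h => hnot (hP.add_mem α hα β hβ h)) (hP.ne_neg hβ hα)]
  induction n with
  | zero =>
    intro α hα β hβ hαβ
    exact hstart α hα β hβ fun h => (hαβ h).trans zero_le_one
  | succ n ih =>
    rcases Nat.eq_zero_or_pos n with rfl | hn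
    · exact hstart
    have hrun : runUpTo Δ P ip ζ η o c₀ (n + 1) =
        stepLevel Δ P ip ζ η o (runUpTo Δ P ip ζ η o c₀ n) (n + 1) := by
      unfold runUpTo
      obtain ⟨k, rfl⟩ : ∃ k, n = k + 1 := ⟨n - 1, by omega⟩
      rw [Nat.add_sub_cancel, Nat.add_sub_cancel, List.range'_1_concat, List.foldl_append,
        List.foldl_cons, List.foldl_nil, show 2 + k = k + 1 + 1 by omega]
    rw [hrun]
    have h := stepLevel_agreesOn hP hc hneg hζη hval hne o (o.rootsOfLevel (n + 1)) ih ?_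
    · intro x hx y hy hxy
      refine h x hx y hy ?_
      by_cases hmem : x + y ∈ P
      · rcases (hxy hmem).lt_or_eq with hlt | heq
        · exact Or.inl fun _ => Nat.lt_succ_iff.1 hlt
        · refine Or.inr ((o.mem_rootsOfLevel _ _).2 ⟨hmem, (hl.hasLevel_iff _ hmem _).2 ?_⟩)
          rw [heq]
      · exact Or.inl fun h => absurd h hmem
    · intro α hα
      obtain ⟨h1, h2⟩ := (o.mem_rootsOfLevel _ _).1 hα
      have h3 : n + 1 = lev α := by exact_mod_cast (hl.hasLevel_iff _ h1 _).1 h2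
      refine ⟨⟨h1, fun hs => ?_⟩, ?_⟩
      · have := hl.map_simple α hs
        omega
      · rintro γ hγ δ hδ rfl _
        have := hl.map_add γ hγ δ hδ h1
        have := hl.one_le δ hδ
        omega

end IsStructureTable

end Tables
end ChevalleyBasis

/-! ### Conjugation and the Killing form of the complexification -/

namespace Complexification
variable {g : Type*} [LieRing g] [LieAlgebra ℝ g]

theorem exists_eq_add (v : Complexification g) : ∃ a b : g, v = of a + Complex.I • of b := by
  induction v using TensorProduct.induction_on with
  | zero =>
    refine ⟨0, 0, ?_⟩
    rw [map_zero, smul_zero, add_zero]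
    rfl
  | tmul z x =>
    refine ⟨z.re • x, z.im • x, ?_⟩
    have h : (z ⊗ₜ[ℝ] x : ℂ ⊗[ℝ] g) = z • ((1 : ℂ) ⊗ₜ[ℝ] x) := by
      rw [TensorProduct.smul_tmul', smul_eq_mul, mul_one]
    have h' : (z ⊗ₜ[ℝ] x : ℂ ⊗[ℝ] g) = (z • of x : Complexification g) := h
    rw [of_smul, of_smul, smul_smul, ← add_smul, mul_comm, Complex.re_add_im]
    exact h'
  | add x y hx hy =>
    obtain ⟨a, b, rfl⟩ := hx
    obtain ⟨c, d, rfl⟩ := hy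
    refine ⟨a + c, b + d, ?_⟩
    rw [map_add, map_add, smul_add]
    exact add_add_add_comm _ _ _ _

theorem conj_of (x : g) : conj g (of x) = of x := by
  change LinearMap.rTensor g Complex.conjAe.toLinearMap ((1 : ℂ) ⊗ₜ[ℝ] x) = (1 : ℂ) ⊗ₜ[ℝ] x
  rw [LinearMap.rTensor_tmul]
  simp

theorem conj_smul (z : ℂ) (v : Complexification g) :
    conj g (z • v) = (starRingEnd ℂ) z • conj g v := by
  induction v using TensorProduct.induction_on with
  | zero =>
    exact (congrArg (conj g) (smul_zero z)).trans ((map_zero (conj g)).trans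
      ((congrArg _ (map_zero (conj g))).trans (smul_zero _)).symm)
  | tmul w x =>
    change LinearMap.rTensor g Complex.conjAe.toLinearMap (z • (w ⊗ₜ[ℝ] x)) =
      (starRingEnd ℂ) z • LinearMap.rTensor g Complex.conjAe.toLinearMap (w ⊗ₜ[ℝ] x)
    rw [TensorProduct.smul_tmul', LinearMap.rTensor_tmul, LinearMap.rTensor_tmul,
      TensorProduct.smul_tmul']
    simp
  | add x y hx hy =>
    exact ((congrArg (conj g) (smul_add z (x : Complexification g) y)).trans
      (map_add (conj g) _ _)).trans ((congrArg₂ (· + ·) hx hy).trans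
      ((smul_add _ _ _).symm.trans (congrArg _ (map_add (conj g) x y).symm)))

theorem conj_add_I_smul (a b : g) :
    conj g (of a + Complex.I • of b) = of a - Complex.I • of b := by
  rw [map_add, conj_smul, conj_of, conj_of, Complex.conj_I, neg_smul, sub_eq_add_neg]

theorem conj_conj (v : Complexification g) : conj g (conj g v) = v := by
  obtain ⟨a, b, rfl⟩ := exists_eq_add v
  rw [conj_add_I_smul, map_sub, conj_smul, conj_of, conj_of, Complex.conj_I, neg_smul, sub_neg_eq_add]

theorem conj_lie (v w : Complexification g) : conj g ⁅v, w⁆ = ⁅conj g v, conj g w⁆ := by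
  obtain ⟨a, b, rfl⟩ := exists_eq_add v
  obtain ⟨c, d, rfl⟩ := exists_eq_add w
  simp only [add_lie, lie_add, smul_lie, lie_smul, lie_of, map_add, conj_smul, conj_of]

theorem eq_zero_of_killingForm_eq_zero [IsCompactLieAlgebra g] {x : g}
    (hx : killingForm ℝ g x x = 0) : x = 0 := by
  by_contra h
  exact (IsCompactLieAlgebra.killingForm_neg x h).ne hx

variable [Module.Finite ℝ g]

variable [IsCompactLieAlgebra g]

theorem of_injective : Function.Injective (of : g → Complexification g) := by
  refine (injective_iff_map_eq_zero _).2 fun x hx => eq_zero_of_killingForm_eq_zero ?_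
  have h := killingForm_of x x
  rw [hx, map_zero] at h
  exact_mod_cast h.symm

/-- The Hermitian form `-κ(X, conj X)` is positive definite. -/
theorem exists_killingForm_conj (v : Complexification g) (hv : v ≠ 0) :
    ∃ r : ℝ, 0 < r ∧ killingForm ℂ (Complexification g) v (conj g v) = -(r : ℂ) := by
  obtain ⟨a, b, rfl⟩ := exists_eq_add v
  have hle : ∀ x : g, killingForm ℝ g x x ≤ 0 := by
    intro x
    by_cases h : x = 0
    · simp [h]
    · exact (IsCompactLieAlgebra.killingForm_neg x h).le
  refine ⟨-(killingForm ℝ g a a + killingForm ℝ g b b), ?_, ?_⟩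
  · by_contra h
    have ha := eq_zero_of_killingForm_eq_zero (le_antisymm (hle a) (by linarith [hle b]))
    have hb := eq_zero_of_killingForm_eq_zero (le_antisymm (hle b) (by linarith [hle a]))
    exact hv (by simp [ha, hb])
  · rw [conj_add_I_smul]
    simp only [map_add, map_sub, map_smul, LinearMap.add_apply,
      LinearMap.smul_apply, killingForm_of, smul_eq_mul, LieModule.traceForm_comm ℝ g g b a]
    push_cast
    linear_combination (killingForm ℝ g b b : ℂ) * (-Complex.I_mul_I)

/-- An element `v` of the Killing radical is orthogonal to `conj v`, so it vanishes by definiteness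
of the Hermitian form. -/
instance instIsKilling : LieAlgebra.IsKilling ℂ (Complexification g) where
  killingCompl_top_eq_bot := by
    rw [eq_bot_iff]
    intro v hv
    rw [LieIdeal.mem_killingCompl] at hv
    rw [LieSubmodule.mem_bot]
    by_contra h
    obtain ⟨r, hr, h'⟩ := exists_killingForm_conj v h
    rw [LieModule.traceForm_comm, hv _ (LieSubmodule.mem_top _)] at h'
    have : (r : ℂ) = 0 := by linear_combination h'
    exact hr.ne' (by exact_mod_cast this)

end Complexification

/-! ### The complexification of a maximal abelian subalgebra is a Cartan subalgebra -/

namespace ChevalleyBasis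
variable {g : Type*} [LieRing g] [LieAlgebra ℝ g]

theorem isLieAbelian_complexify (t : LieSubalgebra ℝ g) [IsLieAbelian t] :
    IsLieAbelian (complexify t) := by
  refine ⟨fun x y => Subtype.ext ?_⟩
  obtain ⟨a, b, hx⟩ := exists_re_im t x x.2
  obtain ⟨c, d, hy⟩ := exists_re_im t y y.2
  have h : ∀ a b : t, ⁅(a : g), (b : g)⁆ = 0 := fun a b =>
    congrArg Subtype.val (trivial_lie_zero t t a b)
  change ⁅(x : Complexification g), (y : Complexification g)⁆ = 0
  rw [hx, hy]
  simp [Complexification.lie_of, h]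

/-- If `a` normalizes `t`, then `κ([a,h],[a,h]) = κ(a,[h,[a,h]]) = 0` because `[a,h]` lies in the
abelian `t`. By definiteness `a` centralizes `t`, so `t + ℝa` is abelian and maximality applies. -/
theorem mem_of_forall_lie_mem [IsCompactLieAlgebra g] {t : LieSubalgebra ℝ g}
    (ht : Maximal (fun s : LieSubalgebra ℝ g => IsLieAbelian s) t) {a : g}
    (ha : ∀ h ∈ t, ⁅a, h⁆ ∈ t) : a ∈ t := by
  have hab : ∀ x ∈ t, ∀ y ∈ t, ⁅x, y⁆ = 0 := fun x hx y hy => by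
    have := ht.prop
    exact congrArg Subtype.val (trivial_lie_zero t t ⟨x, hx⟩ ⟨y, hy⟩)
  have hcomm : ∀ h ∈ t, ⁅a, h⁆ = 0 := by
    intro h hh
    refine Complexification.eq_zero_of_killingForm_eq_zero ?_
    have h1 : killingForm ℝ g ⁅a, h⁆ ⁅a, h⁆ = killingForm ℝ g a ⁅h, ⁅a, h⁆⁆ :=
      LieModule.traceForm_apply_lie_apply ℝ g g a h _
    rw [h1, hab h hh _ (ha h hh), map_zero]
  let s : LieSubalgebra ℝ g :=
    { toSubmodule := t.toSubmodule ⊔ Submodule.span ℝ {a}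
      lie_mem' := by
        intro x y hx hy
        obtain ⟨u, hu, v, hv, rfl⟩ := Submodule.mem_sup.1 hx
        obtain ⟨u', hu', v', hv', rfl⟩ := Submodule.mem_sup.1 hy
        obtain ⟨r, rfl⟩ := Submodule.mem_span_singleton.1 hv
        obtain ⟨r', rfl⟩ := Submodule.mem_span_singleton.1 hv'
        have h0 : ⁅u, a⁆ = 0 := by rw [← lie_skew, hcomm u hu, neg_zero]
        have h1 := hcomm u' hu'
        have h2 := hab u hu u' hu'
        have : ⁅u + r • a, u' + r' • a⁆ = 0 := by simp [h0, h1, h2]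
        change ⁅u + r • a, u' + r' • a⁆ ∈ _
        rw [this]
        exact Submodule.zero_mem _ }
  have hs : IsLieAbelian s := by
    refine ⟨fun x y => Subtype.ext ?_⟩
    obtain ⟨x, hx⟩ := x
    obtain ⟨y, hy⟩ := y
    obtain ⟨u, hu, v, hv, rfl⟩ := Submodule.mem_sup.1 hx
    obtain ⟨u', hu', v', hv', rfl⟩ := Submodule.mem_sup.1 hy
    obtain ⟨r, rfl⟩ := Submodule.mem_span_singleton.1 hv
    obtain ⟨r', rfl⟩ := Submodule.mem_span_singleton.1 hv'
    have h0 : ⁅u, a⁆ = 0 := by rw [← lie_skew, hcomm u hu, neg_zero]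
    have h1 := hcomm u' hu'
    have h2 := hab u hu u' hu'
    change ⁅u + r • a, u' + r' • a⁆ = 0
    simp [h0, h1, h2]
  have hle : t ≤ s := fun x hx => Submodule.mem_sup_left (S := t.toSubmodule) hx
  exact ht.le_of_ge hs hle (Submodule.mem_sup_right (Submodule.mem_span_singleton_self a))

variable [Module.Finite ℝ g] [IsCompactLieAlgebra g]

theorem mem_complexify_iff {t : LieSubalgebra ℝ g} {a b : g} :
    Complexification.of a + Complex.I • Complexification.of b ∈ complexify t ↔ a ∈ t ∧ b ∈ t := by
  constructor
  · intro h
    obtain ⟨c, d, h⟩ := exists_re_im t _ h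
    have h' := congrArg (Complexification.conj g) h
    rw [Complexification.conj_add_I_smul, Complexification.conj_add_I_smul] at h'
    have h1 : (2 : ℂ) • Complexification.of a = (2 : ℂ) • Complexification.of (c : g) := by
      linear_combination (norm := module) h + h'
    have h2 : (2 * Complex.I) • Complexification.of b =
        (2 * Complex.I) • Complexification.of (d : g) := by
      linear_combination (norm := module) h - h'
    rw [Complexification.of_injective (smul_right_injective _ two_ne_zero h1),
      Complexification.of_injective (smul_right_injective _
        (mul_ne_zero two_ne_zero Complex.I_ne_zero) h2)]
    exact ⟨c.2, d.2⟩
  · rintro ⟨ha, hb⟩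
    exact add_mem (incl t ⟨a, ha⟩).2 ((complexify t).smul_mem _ (incl t ⟨b, hb⟩).2)

/-- The real and imaginary parts of an element of the normalizer both normalize `t`. -/
theorem isCartanSubalgebra_complexify {t : LieSubalgebra ℝ g}
    (ht : Maximal (fun s : LieSubalgebra ℝ g => IsLieAbelian s) t) :
    (complexify t).IsCartanSubalgebra where
  nilpotent := by
    have := ht.prop
    have := isLieAbelian_complexify t
    infer_instance
  self_normalizing := by
    refine le_antisymm (fun v hv => ?_) (LieSubalgebra.le_normalizer _)
    rw [LieSubalgebra.mem_normalizer_iff] at hv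
    obtain ⟨a, b, rfl⟩ := Complexification.exists_eq_add v
    have h : ∀ h ∈ t, ⁅a, h⁆ ∈ t ∧ ⁅b, h⁆ ∈ t := by
      intro h hh
      have h1 := hv _ (incl t ⟨h, hh⟩).2
      simp only [incl] at h1
      simp only [add_lie, smul_lie, Complexification.lie_of] at h1
      exact mem_complexify_iff.1 h1
    exact mem_complexify_iff.2 ⟨mem_of_forall_lie_mem ht fun x hx => (h x hx).1,
      mem_of_forall_lie_mem ht fun x hx => (h x hx).2⟩

end ChevalleyBasis

/-! ### Root spaces, reality of the inner product, root strings -/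

namespace ChevalleyBasis
open LieAlgebra.IsKilling LieModule

section RootSpaces
variable {g : Type*} [LieRing g] [LieAlgebra ℝ g] {t : LieSubalgebra ℝ g}

theorem incl_add (a b : t) : incl t (a + b) = incl t a + incl t b :=
  Subtype.ext (map_add Complexification.of (a : g) (b : g))

theorem exists_eq_incl_add (v : complexify t) : ∃ a b : t, v = incl t a + Complex.I • incl t b := by
  obtain ⟨a, b, h⟩ := exists_re_im t v v.2
  exact ⟨a, b, Subtype.ext h⟩

theorem lie_mem_rootSpace {α β : Form t} {X Y : Complexification g} (hX : X ∈ rootSpace t α)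
    (hY : Y ∈ rootSpace t β) : ⁅X, Y⁆ ∈ rootSpace t (α + β) := by
  intro H
  rw [leibniz_lie, hX H, hY H, smul_lie, lie_smul, LinearMap.add_apply, add_smul]

theorem mem_rootSpace_of_forall_incl {α : Form t} {X : Complexification g}
    (h : ∀ a : t, ⁅(incl t a : Complexification g), X⁆ = α (incl t a) • X) : X ∈ rootSpace t α := by
  intro H
  obtain ⟨a, b, rfl⟩ := exists_eq_incl_add H
  change ⁅(incl t a : Complexification g) + Complex.I • (incl t b : Complexification g), X⁆ = _
  rw [add_lie, smul_lie, h, h, map_add, map_smul, add_smul, smul_smul, smul_eq_mul]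

theorem exists_mem_rootSpace {α : Form t} (hα : α ∈ roots t) : ∃ X ∈ rootSpace t α, X ≠ 0 :=
  (Submodule.ne_bot_iff _).1 hα.2

theorem mem_roots {α : Form t} (hα : α ≠ 0) {X : Complexification g} (hX : X ∈ rootSpace t α)
    (h0 : X ≠ 0) : α ∈ roots t :=
  ⟨hα, (Submodule.ne_bot_iff _).2 ⟨X, hX, h0⟩⟩

theorem eq_zero_of_notMem_roots {α : Form t} (hα : α ∉ roots t) (h0 : α ≠ 0)
    {X : Complexification g} (hX : X ∈ rootSpace t α) : X = 0 := by
  by_contra h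
  exact hα (mem_roots h0 hX h)

/-- The linear forms that are purely imaginary on `t`. -/
def IsImaginary (φ : Form t) : Prop := ∀ a : t, (φ (incl t a)).re = 0

theorem conj_mem_rootSpace {α : Form t} (hα : IsImaginary α) {X : Complexification g}
    (hX : X ∈ rootSpace t α) : Complexification.conj g X ∈ rootSpace t (-α) := by
  refine mem_rootSpace_of_forall_incl fun a => ?_
  have h2 : Complexification.conj g (incl t a : Complexification g) = incl t a :=
    Complexification.conj_of _
  have h3 := Complexification.conj_lie (incl t a : Complexification g) X
  rw [h2] at h3
  rw [← h3, hX, Complexification.conj_smul, LinearMap.neg_apply]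
  congr 1
  have := hα a
  apply Complex.ext
  · simp [this]
  · simp

end RootSpaces

section Cartan
variable {g : Type*} [LieRing g] [LieAlgebra ℝ g] [Module.Finite ℝ g] [IsCompactLieAlgebra g]
  {t : LieSubalgebra ℝ g}

theorem flat_sharp (φ : Form t) : flat t (sharp t φ) = φ :=
  (LinearEquiv.ofBijective (flat t) (flat_bijective t)).apply_symm_apply φ

theorem killingForm_sharp (φ : Form t) (H : complexify t) :
    killingForm ℂ (Complexification g) (sharp t φ) H = φ H := by
  rw [← flat_apply, flat_sharp]

theorem formInner_eq_re (φ ψ : Form t) : formInner t φ ψ = (φ (sharp t ψ)).re := by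
  rw [formInner, killingForm_sharp]

/-- By invariance of the Killing form, `ad a` for `a ∈ t` is skew-Hermitian for the definite form
`-κ(X, conj X)`, so its eigenvalues are imaginary. -/
theorem isImaginary_of_mem_roots {α : Form t} (hα : α ∈ roots t) : IsImaginary α := by
  intro a
  obtain ⟨X, hX, h0⟩ := exists_mem_rootSpace hα
  obtain ⟨r, hr, h⟩ := Complexification.exists_killingForm_conj X h0
  have h1 : killingForm ℂ (Complexification g) ⁅X, (incl t a : Complexification g)⁆
        (Complexification.conj g X) =
      killingForm ℂ (Complexification g) X
        ⁅(incl t a : Complexification g), Complexification.conj g X⁆ :=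
    LieModule.traceForm_apply_lie_apply ℂ _ _ _ _ _
  have h2 : Complexification.conj g (incl t a : Complexification g) = incl t a :=
    Complexification.conj_of _
  rw [← h2, ← Complexification.conj_lie, h2, ← lie_skew, hX, Complexification.conj_smul, map_neg,
    map_smul, LinearMap.neg_apply, LinearMap.smul_apply, map_smul, h, smul_eq_mul,
    smul_eq_mul] at h1
  have h3 : (α (incl t a) + (starRingEnd ℂ) (α (incl t a))) * (r : ℂ) = 0 := by
    linear_combination h1
  rw [Complex.add_conj] at h3
  have h4 : 2 * (α (incl t a)).re * r = 0 := by exact_mod_cast h3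
  nlinarith [mul_eq_zero.1 h4 |>.resolve_right hr.ne']

/-- Since `φ♯` lies in `i t`, the inner product of two imaginary forms is minus the Killing form of
two elements of `t`: it is real, and positive on the diagonal. -/
theorem IsImaginary.exists_sharp {φ : Form t} (hφ : IsImaginary φ) :
    ∃ b : t, sharp t φ = Complex.I • incl t b := by
  obtain ⟨a, b, h⟩ := exists_eq_incl_add (sharp t φ)
  have h1 := hφ a
  rw [← killingForm_sharp, h] at h1
  change ((killingForm ℂ (Complexification g) (Complexification.of (a : g) +
    Complex.I • Complexification.of (b : g))) (Complexification.of (a : g))).re = 0 at h1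
  simp only [map_add, map_smul, LinearMap.add_apply, LinearMap.smul_apply,
    Complexification.killingForm_of, smul_eq_mul, Complex.add_re, Complex.ofReal_re, Complex.mul_re,
    Complex.I_re, Complex.I_im, Complex.ofReal_im, zero_mul, mul_zero, sub_zero, add_zero] at h1
  have h2 : a = 0 := Subtype.ext (Complexification.eq_zero_of_killingForm_eq_zero h1)
  refine ⟨b, ?_⟩
  rw [h, h2, show incl t 0 = 0 from Subtype.ext (map_zero Complexification.of), zero_add]

theorem apply_sharp_eq_neg {φ ψ : Form t} {a b : t} (ha : sharp t φ = Complex.I • incl t a)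
    (hb : sharp t ψ = Complex.I • incl t b) :
    φ (sharp t ψ) = ((-killingForm ℝ g a b : ℝ) : ℂ) := by
  rw [← killingForm_sharp, ha, hb]
  change (killingForm ℂ (Complexification g) (Complex.I • Complexification.of (a : g)))
    (Complex.I • Complexification.of (b : g)) = _
  simp only [map_smul, LinearMap.smul_apply, Complexification.killingForm_of, smul_eq_mul]
  push_cast
  linear_combination (killingForm ℝ g a b : ℂ) * Complex.I_mul_I

theorem ofReal_formInner {φ ψ : Form t} (hφ : IsImaginary φ) (hψ : IsImaginary ψ) :
    (formInner t φ ψ : ℂ) = φ (sharp t ψ) := by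
  obtain ⟨a, ha⟩ := hφ.exists_sharp
  obtain ⟨b, hb⟩ := hψ.exists_sharp
  rw [formInner_eq_re, apply_sharp_eq_neg ha hb, Complex.ofReal_re]

theorem formInner_self_pos {φ : Form t} (hφ : IsImaginary φ) (h0 : φ ≠ 0) :
    0 < formInner t φ φ := by
  obtain ⟨a, ha⟩ := hφ.exists_sharp
  rw [formInner_eq_re, apply_sharp_eq_neg ha ha, Complex.ofReal_re, neg_pos]
  refine IsCompactLieAlgebra.killingForm_neg _ fun h => h0 ?_
  apply (sharp t).injective
  rw [ha, map_zero, show incl t a = 0 from Subtype.ext (by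
    change Complexification.of (a : g) = 0
    rw [h, map_zero]), smul_zero]

theorem neg_mem_roots {α : Form t} (hα : α ∈ roots t) : -α ∈ roots t := by
  obtain ⟨X, hX, h0⟩ := exists_mem_rootSpace hα
  refine mem_roots (neg_ne_zero.2 hα.1) (conj_mem_rootSpace (isImaginary_of_mem_roots hα) hX) ?_
  intro h
  exact h0 (by rw [← Complexification.conj_conj X, h, map_zero])

variable [hH : (complexify t).IsCartanSubalgebra]

/-- The right-hand side is a generalized eigenspace; the two agree because a Cartan subalgebra acts
semisimply when the Killing form is nondegenerate. -/
theorem mem_rootSpace_iff {α : Form t} {X : Complexification g} :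
    X ∈ rootSpace t α ↔ X ∈ LieAlgebra.rootSpace (complexify t) α := by
  constructor
  · intro h
    exact weightSpace_le_genWeightSpace _ _ ((mem_weightSpace _ _).2 fun H => h H)
  · intro h H
    exact lie_eq_smul_of_mem_rootSpace h H

theorem rootSpace_ne_bot_iff {α : Form t} :
    rootSpace t α ≠ ⊥ ↔ LieAlgebra.rootSpace (complexify t) α ≠ ⊥ := by
  rw [Submodule.ne_bot_iff, ne_eq, LieSubmodule.eq_bot_iff]
  push Not
  simp only [mem_rootSpace_iff, ne_eq]

theorem exists_weight {α : Form t} (hα : α ∈ roots t) :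
    ∃ w : Weight ℂ (complexify t) (Complexification g), w.IsNonZero ∧
      (w : complexify t → ℂ) = α ∧ w.toLinear = α := by
  refine ⟨⟨α, rootSpace_ne_bot_iff.1 hα.2⟩, fun h => hα.1 ?_, rfl, rfl⟩
  exact LinearMap.ext fun x => congrFun h x

theorem finite_roots : (roots t).Finite := by
  refine (Set.finite_range (Weight.toLinear ℂ (complexify t) (Complexification g))).subset ?_
  intro α hα
  obtain ⟨w, -, -, h⟩ := exists_weight hα
  exact ⟨w, h⟩

theorem cartanEquivDual_symm_eq (φ : Form t) :
    (cartanEquivDual (complexify t)).symm φ = sharp t φ := by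
  apply (flat_bijective t).1
  rw [flat_sharp]
  exact (cartanEquivDual (complexify t)).apply_symm_apply φ

theorem exists_eq_smul {α : Form t} (hα : α ∈ roots t) {X Y : Complexification g}
    (hX : X ∈ rootSpace t α) (h0 : X ≠ 0) (hY : Y ∈ rootSpace t α) : ∃ c : ℂ, Y = c • X := by
  obtain ⟨w, hw, hwα, -⟩ := exists_weight hα
  rw [mem_rootSpace_iff, ← hwα] at hX hY
  obtain ⟨c, hc⟩ := (finrank_eq_one_iff_of_nonzero' (⟨X, hX⟩ : LieAlgebra.rootSpace _ w)
    (fun h => h0 (congrArg Subtype.val h))).1 (finrank_rootSpace_eq_one w hw) ⟨Y, hY⟩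
  exact ⟨c, (congrArg Subtype.val hc).symm⟩

theorem lie_eq_smul_sharp {α : Form t} (hα : α ∈ roots t) {X Y : Complexification g}
    (hX : X ∈ rootSpace t α) (hY : Y ∈ rootSpace t (-α)) :
    ⁅X, Y⁆ = killingForm ℂ (Complexification g) X Y • (sharp t α : Complexification g) := by
  obtain ⟨w, -, hwα, hwα'⟩ := exists_weight hα
  have hX' := mem_rootSpace_iff.1 hX
  have hY' := mem_rootSpace_iff.1 hY
  rw [show ((-α : Form t) : complexify t → ℂ) = -(α : complexify t → ℂ) from rfl] at hY'
  rw [← hwα] at hX' hY'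
  rw [lie_eq_killingForm_smul_of_mem_rootSpace_of_mem_rootSpace_neg hX' hY',
    ← cartanEquivDual_symm_eq, hwα']

theorem eq_or_eq_neg_of_eq_smul {α β : Form t} (hα : α ∈ roots t) (hβ : β ∈ roots t) (k : ℂ)
    (h : β = k • α) : β = -α ∨ β = α := by
  obtain ⟨v, hv, hvα, -⟩ := exists_weight hα
  obtain ⟨w, hw, hwβ, -⟩ := exists_weight hβ
  rcases eq_neg_or_eq_of_eq_smul v w hw k (by rw [hwβ, hvα, h]; rfl) with h | h
  · left
    apply LinearMap.ext
    intro x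
    rw [← congrFun hwβ x, h, LinearMap.neg_apply, ← congrFun hvα x]
    rfl
  · right
    apply LinearMap.ext
    intro x
    rw [← congrFun hwβ x, h, ← congrFun hvα x]

theorem add_self_notMem_roots {α : Form t} (hα : α ∈ roots t) : α + α ∉ roots t := by
  intro h
  rcases eq_or_eq_neg_of_eq_smul hα h 2 (two_smul ℂ α).symm with h' | h'
  · have h3 : (3 : ℂ) • α = 0 := by linear_combination (norm := module) h'
    exact hα.1 ((smul_eq_zero.1 h3).resolve_left three_ne_zero)
  · exact hα.1 (by simpa using h')

/-- The root space of the zero form contains the Cartan subalgebra, which is nonzero as soon as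
there is a root `α`. Hence strings given by nonzero weight spaces are strings in `Δ ∪ {0}`. -/
theorem rootSpace_ne_bot_iff_mem {α φ : Form t} (hα : α ∈ roots t) :
    rootSpace t φ ≠ ⊥ ↔ φ ∈ roots t ∨ φ = 0 := by
  constructor
  · intro h
    by_cases h' : φ = 0
    · exact Or.inr h'
    · exact Or.inl ⟨h', h⟩
  · rintro (h | rfl)
    · exact h.2
    · have hnt : ∃ x : complexify t, α x ≠ 0 := by
        by_contra h
        push Not at h
        exact hα.1 (LinearMap.ext h)
      obtain ⟨x, hx⟩ := hnt
      refine (Submodule.ne_bot_iff _).2 ⟨x, fun H => ?_, fun h => hx ?_⟩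
      · rw [LinearMap.zero_apply, zero_smul]
        exact congrArg Subtype.val (trivial_lie_zero (complexify t) (complexify t) H x)
      · rw [show x = 0 from Subtype.ext h, map_zero]

/-- The `α`-string through `β`, with Cartan integer `p - q`. -/
theorem exists_isString {α β : Form t} (hα : α ∈ roots t) (hβ : β ∈ roots t) :
    ∃ p q : ℕ, IsString (roots t) α β p q ∧
      2 * formInner t β α = ((p : ℝ) - q) * formInner t α α := by
  obtain ⟨v, hv, hvα, hvα'⟩ := exists_weight hα
  obtain ⟨w, hw, hwβ, hwβ'⟩ := exists_weight hβ
  refine ⟨chainBotCoeff v w, chainTopCoeff v w, ?_, ?_⟩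
  · intro k
    have h2 : ((β + k • α : Form t) : complexify t → ℂ) = k • (v : complexify t → ℂ) + w := by
      rw [hvα, hwβ, add_comm]
      rfl
    rw [← rootSpace_ne_bot_iff_mem hα, rootSpace_ne_bot_iff, h2, rootSpace_zsmul_add_ne_bot_iff v w hv]
    omega
  · have h1 := apply_coroot_eq_cast v w
    have h2 : α (sharp t α) ≠ 0 := by
      rw [← ofReal_formInner (isImaginary_of_mem_roots hα) (isImaginary_of_mem_roots hα)]
      exact_mod_cast (formInner_self_pos (isImaginary_of_mem_roots hα) hα.1).ne'
    rw [coroot, hvα', cartanEquivDual_symm_eq, hvα, hwβ, map_nsmul, map_smul, smul_eq_mul,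
      nsmul_eq_mul] at h1
    have h3 : 2 * β (sharp t α) =
        ((chainBotCoeff v w : ℂ) - chainTopCoeff v w) * α (sharp t α) := by
      push_cast at h1
      field_simp at h1
      rw [hvα]
      linear_combination h1
    rw [← ofReal_formInner (isImaginary_of_mem_roots hα) (isImaginary_of_mem_roots hα),
      ← ofReal_formInner (isImaginary_of_mem_roots hβ) (isImaginary_of_mem_roots hα)] at h3
    exact_mod_cast h3

/-- The action of `ad X_{-α} ∘ ad X_α` on root vectors. -/
theorem lie_lie_of_isString {α β : Form t} (hα : α ∈ roots t) (hβ : β ∈ roots t) {p q : ℕ}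
    (hs : IsString (roots t) α β p q)
    (hpq : 2 * formInner t β α = ((p : ℝ) - q) * formInner t α α)
    {X Y V : Complexification g} (hX : X ∈ rootSpace t α) (hY : Y ∈ rootSpace t (-α))
    (hXY : ⁅X, Y⁆ = (sharp t α : Complexification g)) (hV : V ∈ rootSpace t β) :
    ⁅Y, ⁅X, V⁆⁆ = ((q * (1 + p) / 2 * formInner t α α : ℝ) : ℂ) • V := by
  have hαi := isImaginary_of_mem_roots hα
  have hs0 : (formInner t α α : ℂ) ≠ 0 := by exact_mod_cast (formInner_self_pos hαi hα.1).ne'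
  have hαα := ofReal_formInner hαi hαi
  have hβα := ofReal_formInner (isImaginary_of_mem_roots hβ) hαi
  set s : ℂ := (formInner t α α : ℂ) with hs_def
  have hX' := hX (sharp t α)
  have hY' := hY (sharp t α)
  rw [LinearMap.neg_apply] at hY'
  rw [← hαα] at hX' hY'
  -- The roles are reversed: `Y`, of weight `-α`, is the raising operator. A primitive vector is
  -- then found at the bottom `β - pα` of the string, and its weight is `p + q`.
  have hsl : IsSl2Triple (-(2 / s) • (sharp t α : Complexification g)) Y ((2 / s) • X) := by
    refine ⟨?_, ?_, ?_, ?_⟩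
    · refine smul_ne_zero (neg_ne_zero.2 (div_ne_zero two_ne_zero hs0)) fun h => hα.1 ?_
      apply (sharp t).injective
      rw [map_zero]
      exact Subtype.ext h
    · rw [lie_smul, ← lie_skew, hXY, smul_neg, neg_smul]
    · rw [smul_lie, hY', smul_smul, ← Nat.cast_smul_eq_nsmul ℂ]
      congr 1
      field_simp
      norm_num
    · rw [smul_lie, lie_smul, hX', smul_smul, smul_smul, ← Nat.cast_smul_eq_nsmul ℂ, smul_smul,
        ← neg_smul]
      congr 1
      field_simp
      norm_num
  have hbot : rootSpace t (β + (-(p : ℤ)) • α) ≠ ⊥ ∧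
      rootSpace t (-α + (β + (-(p : ℤ)) • α)) = ⊥ := by
    constructor
    · exact (rootSpace_ne_bot_iff_mem hα).2 ((hs _).2 ⟨le_rfl, by omega⟩)
    · by_contra h
      rw [show -α + (β + (-(p : ℤ)) • α) = β + (-(p : ℤ) - 1) • α by module] at h
      have := (hs _).1 ((rootSpace_ne_bot_iff_mem hα).1 h)
      omega
  obtain ⟨m, hm, hm0⟩ := (Submodule.ne_bot_iff _).1 hbot.1
  have hprim : hsl.HasPrimitiveVectorWith m ((p + q : ℕ) : ℂ) := by
    refine ⟨hm0, ?_, ?_⟩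
    · rw [smul_lie, hm, smul_smul]
      congr 1
      have h2 : 2 * (formInner t β α : ℂ) = ((p : ℂ) - q) * s := by
        rw [hs_def]
        exact_mod_cast hpq
      rw [LinearMap.add_apply, LinearMap.smul_apply, ← hαα, ← hβα]
      simp only [zsmul_eq_mul]
      push_cast
      field_simp
      linear_combination -h2
    · have := lie_mem_rootSpace hY hm
      rwa [hbot.2, Submodule.mem_bot] at this
  have hpow : ∀ n : ℕ, ((toEnd ℂ (Complexification g) (Complexification g) ((2 / s) • X)) ^ n) m ∈
      rootSpace t (n • α + (β + (-(p : ℤ)) • α)) := by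
    intro n
    induction n with
    | zero => simpa using hm
    | succ n ih =>
      rw [pow_succ', Module.End.mul_apply, toEnd_apply_apply, succ_nsmul', add_assoc]
      exact lie_mem_rootSpace ((rootSpace t α).smul_mem _ hX) ih
  -- By one-dimensionality, `V` is a multiple of `f ^ p m`. The identity `e f ^ (p + 1) m = (p +
  -- 1)((p + q) - p) f ^ p m`, with `f = (2 / s) X`, yields the eigenvalue `q(1 + p)s/2`.
  have hmem := hpow p
  rw [show p • α + (β + (-(p : ℤ)) • α) = β by module] at hmem
  obtain ⟨c, rfl⟩ := exists_eq_smul hβ hmem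
    (hprim.pow_toEnd_f_ne_zero_of_eq_nat rfl (Nat.le_add_right p q)) hV
  have h1 := hprim.lie_e_pow_succ_toEnd_f p
  rw [pow_succ', Module.End.mul_apply, toEnd_apply_apply, smul_lie, lie_smul] at h1
  have h2 := congrArg (fun v => (s / 2) • v) h1
  simp only [smul_smul] at h2
  rw [show s / 2 * (2 / s) = 1 by field_simp, one_smul] at h2
  rw [lie_smul, lie_smul, h2, smul_smul, smul_smul]
  congr 1
  push_cast
  rw [← hs_def]
  ring

end Cartan

end ChevalleyBasis

/-! ### Positive roots and independence of the simple roots -/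

namespace ChevalleyBasis

section PositiveRoots
variable {g : Type*} [LieRing g] [LieAlgebra ℝ g] {t : LieSubalgebra ℝ g}

/-- The imaginary part of the value at `H₀`. -/
def height (H₀ : t) : Form t →+ ℝ :=
  Complex.imAddGroupHom.comp (LinearMap.applyₗ (R := ℂ) (incl t H₀)).toAddMonoidHom

theorem height_apply (H₀ : t) (φ : Form t) : height H₀ φ = (φ (incl t H₀)).im := rfl

theorem height_pos {H₀ : t} {α : Form t} (hα : α ∈ posRoots t H₀) : 0 < height H₀ α := by
  obtain ⟨-, r, hr, h⟩ := hα
  rw [height_apply, h]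
  simpa using hr

variable [Module.Finite ℝ g] [IsCompactLieAlgebra g]

theorem mem_posRoots_iff {H₀ : t} {α : Form t} (hα : α ∈ roots t) :
    α ∈ posRoots t H₀ ↔ 0 < height H₀ α := by
  refine ⟨height_pos, fun h => ⟨hα, height H₀ α, h, ?_⟩⟩
  apply Complex.ext
  · simpa using isImaginary_of_mem_roots hα H₀
  · simp [height_apply]

variable [hH : (complexify t).IsCartanSubalgebra]

theorem isPositiveSystem_posRoots {H₀ : t} (hH₀ : ∀ α ∈ roots t, α (incl t H₀) ≠ 0) :
    IsPositiveSystem (roots t) (posRoots t H₀) where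
  finite := finite_roots.subset fun α hα => hα.1
  neg_mem := fun α => neg_mem_roots
  subset := fun α hα => hα.1
  mem_or := by
    intro α hα
    rw [mem_posRoots_iff hα, mem_posRoots_iff (neg_mem_roots hα), map_neg, neg_pos]
    refine (lt_or_gt_of_ne fun h => hH₀ α hα ?_).symm
    exact Complex.ext (isImaginary_of_mem_roots hα H₀) h
  neg_notMem := by
    intro α hα h
    have h1 := height_pos h
    rw [map_neg] at h1
    linarith [height_pos hα]
  add_mem := by
    intro α hα β hβ h
    rw [mem_posRoots_iff h, map_add]
    exact add_pos (height_pos hα) (height_pos hβ)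
  add_self_notMem := fun α => add_self_notMem_roots

/-- The `α`-string through `β` starts at `β`, so `p = 0` and `2⟨β, α⟩ = -q‖α‖²`. -/
theorem formInner_nonpos_of_sub_notMem {α β : Form t} (hα : α ∈ roots t) (hβ : β ∈ roots t)
    (hne : β ≠ α) (h : β - α ∉ roots t) : formInner t β α ≤ 0 := by
  obtain ⟨p, q, hs, hpq⟩ := exists_isString hα hβ
  have hp : p = 0 := by
    by_contra hp
    have h1 := (hs (-1)).2 ⟨by omega, by omega⟩
    rw [neg_one_smul, ← sub_eq_add_neg] at h1
    exact h1.elim h fun h2 => hne (sub_eq_zero.1 h2)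
  have hpos := formInner_self_pos (isImaginary_of_mem_roots hα) hα.1
  rw [hp] at hpq
  have : 0 ≤ (q : ℝ) * formInner t α α := by positivity
  push_cast at hpq
  linarith

theorem sub_notMem_roots_of_mem_simpleRoots {H₀ : t} (hH₀ : ∀ α ∈ roots t, α (incl t H₀) ≠ 0)
    {α β : Form t} (hα : α ∈ simpleRoots (posRoots t H₀)) (hβ : β ∈ simpleRoots (posRoots t H₀)) :
    β - α ∉ roots t := by
  intro h
  rcases (isPositiveSystem_posRoots hH₀).sub_mem_cases h with h | h
  · exact hβ.2 ⟨α, hα.1, β - α, h, by abel⟩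
  · exact hα.2 ⟨β, hβ.1, α - β, h, by abel⟩

/-- Vectors in an open half-space of a Euclidean space with pairwise nonpositive inner products are
independent. This is applied in `t` with `-κ` to the vectors `b α` with `α♯ = i b α`; the half-space
comes from `H₀`, as `κ(b α, H₀)` is the imaginary part of `α(H₀)`. -/
theorem linearIndepOn_simpleRoots {H₀ : t} (hH₀ : ∀ α ∈ roots t, α (incl t H₀) ≠ 0) :
    LinearIndepOn ℤ id (simpleRoots (posRoots t H₀)) := by
  have hex : ∀ α : simpleRoots (posRoots t H₀),
      ∃ b : t, sharp t (α : Form t) = Complex.I • incl t b :=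
    fun α => (isImaginary_of_mem_roots α.2.1.1).exists_sharp
  choose b hb using hex
  let κ : LinearMap.BilinForm ℝ t :=
    (killingForm ℝ g).domRestrict₁₂ t.toSubmodule t.toSubmodule
  have hκ : ∀ x y : t, κ x y = killingForm ℝ g x y := fun x y => rfl
  have hpos : ((-κ).toQuadraticMap).PosDef := by
    intro x hx
    rw [LinearMap.BilinMap.toQuadraticMap_apply, LinearMap.neg_apply, LinearMap.neg_apply, hκ,
      neg_pos]
    exact IsCompactLieAlgebra.killingForm_neg _ fun h => hx (Subtype.ext h)
  have hli : LinearIndependent ℝ b := by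
    refine LinearMap.BilinForm.linearIndependent_of_pairwise_le_zero (-κ) hpos (κ.flip H₀) b ?_ ?_
    · intro α
      have h := height_pos α.2.1
      rw [height_apply, ← killingForm_sharp, hb α] at h
      change 0 < ((killingForm ℂ (Complexification g) (Complex.I • Complexification.of (b α : g)))
        (Complexification.of (H₀ : g))).im at h
      rw [map_smul, LinearMap.smul_apply, Complexification.killingForm_of] at h
      simpa [hκ] using h
    · intro α β hne
      have h := formInner_nonpos_of_sub_notMem β.2.1.1 α.2.1.1 (fun h => hne (Subtype.ext h))
        (sub_notMem_roots_of_mem_simpleRoots hH₀ β.2 α.2)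
      rw [formInner_eq_re, apply_sharp_eq_neg (hb α) (hb β), Complex.ofReal_re] at h
      exact h
  -- The inverse of `α ↦ b α`, which carries independence over `ℤ` back to the forms.
  let J : t →+ Form t :=
    { toFun := fun x => flat t (Complex.I • incl t x)
      map_zero' := by
        rw [show incl t 0 = 0 from Subtype.ext (map_zero Complexification.of), smul_zero, map_zero]
      map_add' := fun x y => by rw [incl_add, smul_add, map_add] }
  have hJ : Function.Injective J := by
    intro x y h
    have h1 := smul_right_injective _ Complex.I_ne_zero ((flat_bijective t).1 h)
    exact Subtype.ext (Complexification.of_injective (congrArg Subtype.val h1))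
  have hli' : LinearIndependent ℤ b := hli.restrict_scalars (by
    intro m n h
    simpa using h)
  have h2 := hli'.map' J.toIntLinearMap (LinearMap.ker_eq_bot.2 hJ)
  refine (linearIndependent_equiv' (Equiv.refl _) ?_).1 h2
  funext α
  change (α : Form t) = flat t (Complex.I • incl t (b α))
  rw [← hb α, flat_sharp]

end PositiveRoots

/-! ### Structure constants of normalized root vectors -/

section WeylBases
variable {g : Type*} [LieRing g] [LieAlgebra ℝ g] [Module.Finite ℝ g] [IsCompactLieAlgebra g]
  {t : LieSubalgebra ℝ g}

/-- Root vectors normalized by `[X_α, X_{-α}] = α♯`, with complex structure constants `N`. -/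
structure IsWeylBasis (t : LieSubalgebra ℝ g) (X : Form t → Complexification g)
    (N : Form t → Form t → ℂ) : Prop where
  mem_rootSpace : ∀ α ∈ roots t, X α ∈ rootSpace t α
  lie_of_add_mem : ∀ α ∈ roots t, ∀ β ∈ roots t, α + β ∈ roots t →
    ⁅X α, X β⁆ = N α β • X (α + β)
  lie_neg : ∀ α ∈ roots t, ⁅X α, X (-α)⁆ = (sharp t α : Complexification g)
  eq_zero : ∀ α ∈ roots t, ∀ β ∈ roots t, α + β ∉ roots t → β ≠ -α → N α β = 0

theorem IsChevalleyBasis.isWeylBasis {X : Form t → Complexification g} {c : Form t → Form t → ℝ}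
    (h : IsChevalleyBasis t X c) : IsWeylBasis t X fun α β => (c α β : ℂ) where
  mem_rootSpace := h.mem_rootSpace
  lie_of_add_mem := h.lie_of_add_mem
  lie_neg := fun α hα => h.lie_of_add_eq_zero α hα _ (neg_mem_roots hα) (add_neg_cancel α)
  eq_zero := fun α hα β hβ h1 h2 => by rw [h.eq_zero α hα β hβ h1 h2, Complex.ofReal_zero]

namespace IsWeylBasis
variable {X : Form t → Complexification g} {N : Form t → Form t → ℂ}

theorem ne_zero (h : IsWeylBasis t X N) {α : Form t} (hα : α ∈ roots t) : X α ≠ 0 := by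
  intro h0
  have h1 := h.lie_neg α hα
  rw [h0, zero_lie] at h1
  exact hα.1 ((sharp t).injective (Subtype.ext (by rw [← h1, map_zero]; rfl)))

theorem lie_eq (h : IsWeylBasis t X N) {α β : Form t} (hα : α ∈ roots t) (hβ : β ∈ roots t)
    (hne : β ≠ -α) : ⁅X α, X β⁆ = N α β • X (α + β) := by
  by_cases hm : α + β ∈ roots t
  · exact h.lie_of_add_mem α hα β hβ hm
  · rw [h.eq_zero α hα β hβ hm hne, zero_smul]
    exact eq_zero_of_notMem_roots hm (fun h0 => hne (eq_neg_of_add_eq_zero_right h0))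
      (lie_mem_rootSpace (h.mem_rootSpace α hα) (h.mem_rootSpace β hβ))

theorem skew (h : IsWeylBasis t X N) {α β : Form t} (hα : α ∈ roots t) (hβ : β ∈ roots t)
    (hne : β ≠ -α) : N β α = -N α β := by
  by_cases hm : α + β ∈ roots t
  · have h1 := lie_skew (X α) (X β)
    rw [h.lie_eq hα hβ hne, h.lie_eq hβ hα fun h => hne (by rw [h, neg_neg]), add_comm β α,
      ← neg_smul] at h1
    have h2 := smul_left_injective ℂ (h.ne_zero hm) h1
    rw [← h2, neg_neg]
  · rw [h.eq_zero α hα β hβ hm hne,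
      h.eq_zero β hβ α hα (by rwa [add_comm]) fun h => hne (by rw [h, neg_neg]), neg_zero]

variable [hH : (complexify t).IsCartanSubalgebra]

/-- The Jacobi identity gives `N β γ • α + N γ α • β + N α β • γ = 0`. Substituting `γ = -α - β`,
unequal constants would make `α` proportional to `β`, so `α = ±β`; then `γ = 0` or `γ = -2β`,
neither of which is a root. -/
theorem cyclic (h : IsWeylBasis t X N) {α β γ : Form t} (hα : α ∈ roots t) (hβ : β ∈ roots t)
    (hγ : γ ∈ roots t) (h0 : α + β + γ = 0) : N α β = N β γ := by
  have key : ∀ α ∈ roots t, ∀ β ∈ roots t, ∀ γ ∈ roots t, α + β + γ = 0 →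
      ⁅X α, ⁅X β, X γ⁆⁆ = N β γ • (sharp t α : Complexification g) := by
    intro α hα β hβ γ hγ h0
    have h1 : β + γ = -α := by linear_combination (norm := module) h0
    rw [h.lie_of_add_mem β hβ γ hγ (h1 ▸ neg_mem_roots hα), h1, lie_smul, h.lie_neg α hα]
  have hj := lie_jacobi (X α) (X β) (X γ)
  rw [key α hα β hβ γ hγ h0, key β hβ γ hγ α hα (by rw [← h0]; abel),
    key γ hγ α hα β hβ (by rw [← h0]; abel)] at hj
  have hj' : N β γ • sharp t α + N γ α • sharp t β + N α β • sharp t γ = 0 := Subtype.ext hj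
  rw [← map_smul, ← map_smul, ← map_smul, ← map_add, ← map_add,
    LinearEquiv.map_eq_zero_iff] at hj'
  have hγ' : γ = -α - β := by linear_combination (norm := module) h0
  by_contra hne
  have h2 : α = ((N α β - N γ α) / (N β γ - N α β)) • β := by
    have h3 : N β γ - N α β ≠ 0 := sub_ne_zero.2 (Ne.symm hne)
    rw [hγ'] at hj'
    have h4 : (N β γ - N α β) • α = (N α β - N γ α) • β := by
      rw [hγ']
      linear_combination (norm := module) hj'
    rw [div_eq_inv_mul, mul_smul, ← h4, smul_smul, inv_mul_cancel₀ h3, one_smul]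
  rcases eq_or_eq_neg_of_eq_smul hβ hα _ h2 with h3 | h3
  · rw [h3, neg_add_cancel, zero_add] at h0
    exact hγ.1 h0
  · rw [h3] at h0
    refine add_self_notMem_roots hβ ?_
    rw [eq_neg_of_add_eq_zero_left h0]
    exact neg_mem_roots hγ

/-- One of the three terms of the Jacobi identity behind the four-root relation; all three are
multiples of `X (-δ)`. Cyclicity gives `N γ (α + β) = N δ γ`, and both sides vanish if `α + β` is
not a root. -/
theorem lie_lie_eq (h : IsWeylBasis t X N) {α β γ δ : Form t} (hα : α ∈ roots t)
    (hβ : β ∈ roots t) (hγ : γ ∈ roots t) (hδ : δ ∈ roots t) (h0 : α + β + γ + δ = 0)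
    (hαβ : α ≠ -β) (hγδ : γ ≠ -δ) :
    ⁅X γ, ⁅X α, X β⁆⁆ = (-(N α β * N γ δ)) • X (-δ) := by
  have hβα : β ≠ -α := fun h => hαβ (by rw [h, neg_neg])
  have hδγ : δ ≠ -γ := fun h => hγδ (by rw [h, neg_neg])
  rw [h.lie_eq hα hβ hβα, lie_smul]
  by_cases hm : α + β ∈ roots t
  · have h1 : γ + (α + β) = -δ := by linear_combination (norm := module) h0
    rw [h.lie_of_add_mem γ hγ _ hm (h1 ▸ neg_mem_roots hδ), h1, smul_smul,
      h.cyclic hγ hm hδ (by rw [h1, neg_add_cancel]),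
      h.cyclic hm hδ hγ (by rw [← h0]; abel), h.skew hγ hδ hδγ, mul_neg]
  · rw [h.eq_zero α hα β hβ hm hβα, zero_smul, zero_mul, neg_zero, zero_smul]

theorem isStructureTable (h : IsWeylBasis t X N) : IsStructureTable (roots t) N where
  eq_zero := h.eq_zero
  skew := fun α hα β hβ => h.skew hα hβ
  cyclic := fun α hα β hβ γ hγ => h.cyclic hα hβ hγ
  four := by
    intro α hα β hβ γ hγ δ hδ h0 hαβ hαγ hαδ hβγ hβδ hγδ
    have hj := lie_jacobi (X γ) (X α) (X β)
    rw [h.lie_lie_eq hα hβ hγ hδ h0 hαβ hγδ,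
      h.lie_lie_eq hβ hγ hα hδ (by rw [← h0]; abel) hβγ hαδ,
      h.lie_lie_eq hγ hα hβ hδ (by rw [← h0]; abel) (fun h => hαγ (by rw [h, neg_neg])) hβδ,
      ← add_smul, ← add_smul] at hj
    have := (smul_eq_zero.1 hj).resolve_right (h.ne_zero (neg_mem_roots hδ))
    linear_combination -this

/-- The eigenvalue of `ad X_{-α} ∘ ad X_α` on `X_β` is `N α β * N (-α) (α + β)`, and cyclicity turns
the second factor into `-N (-α) (-β)`. If `α + β` is not a root, then `q = 0`. -/
theorem mul_neg_neg (h : IsWeylBasis t X N) {α β : Form t} (hα : α ∈ roots t) (hβ : β ∈ roots t)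
    (hne : β ≠ -α) {p q : ℕ} (hs : IsString (roots t) α β p q)
    (hpq : 2 * formInner t β α = ((p : ℝ) - q) * formInner t α α) :
    N α β * N (-α) (-β) = -((q * (1 + p) / 2 * formInner t α α : ℝ) : ℂ) := by
  have hα' := neg_mem_roots hα
  have hβ' := neg_mem_roots hβ
  by_cases hm : α + β ∈ roots t
  · have h1 := lie_lie_of_isString hα hβ hs hpq (h.mem_rootSpace α hα) (h.mem_rootSpace _ hα')
      (h.lie_neg α hα) (h.mem_rootSpace β hβ)
    have h2 : -α + (α + β) = β := by abel
    rw [h.lie_of_add_mem α hα β hβ hm, lie_smul,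
      h.lie_of_add_mem _ hα' _ hm (by rwa [h2]), h2, smul_smul] at h1
    have h3 := smul_left_injective ℂ (h.ne_zero hβ) h1
    rw [← h3, h.cyclic hα' hm hβ' (by abel), h.cyclic hm hβ' hα' (by abel),
      h.skew hα' hβ' fun h => hne (neg_injective h)]
    ring
  · have hq : q = 0 := by
      by_contra hq
      have h1 := (hs 1).2 ⟨by omega, by omega⟩
      rw [one_smul, add_comm] at h1
      exact h1.elim hm fun h0 => hne (eq_neg_of_add_eq_zero_right h0)
    rw [h.eq_zero α hα β hβ hm hne, hq]
    simp

theorem ne_zero_of_add_mem (h : IsWeylBasis t X N) {α β : Form t} (hα : α ∈ roots t)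
    (hβ : β ∈ roots t) (hm : α + β ∈ roots t) : N α β ≠ 0 := by
  have hne : β ≠ -α := by
    rintro rfl
    exact hm.1 (add_neg_cancel α)
  obtain ⟨p, q, hs, hpq⟩ := exists_isString hα hβ
  intro h0
  have h1 := h.mul_neg_neg hα hβ hne hs hpq
  have hq : 1 ≤ q := by
    have := (hs 1).1 (Or.inl (by rwa [one_smul, add_comm]))
    omega
  rw [h0, zero_mul, zero_eq_neg] at h1
  have h2 : (q : ℝ) * (1 + p) / 2 * formInner t α α = 0 := by exact_mod_cast h1
  have := formInner_self_pos (isImaginary_of_mem_roots hα) hα.1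
  have : 0 < (q : ℝ) * (1 + p) / 2 * formInner t α α := by positivity
  linarith

end IsWeylBasis

namespace IsChevalleyBasis
variable {X : Form t → Complexification g} {c : Form t → Form t → ℝ}
variable [hH : (complexify t).IsCartanSubalgebra]

theorem isStructureTable (h : IsChevalleyBasis t X c) : IsStructureTable (roots t) c where
  eq_zero := h.eq_zero
  skew := fun α hα β hβ hne => by exact_mod_cast h.isWeylBasis.skew hα hβ hne
  cyclic := fun α hα β hβ γ hγ h0 => by exact_mod_cast h.isWeylBasis.cyclic hα hβ hγ h0
  four := fun α hα β hβ γ hγ δ hδ h0 h1 h2 h3 h4 h5 h6 => by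
    exact_mod_cast h.isWeylBasis.isStructureTable.four α hα β hβ γ hγ δ hδ h0 h1 h2 h3 h4 h5 h6

theorem sq_eq (h : IsChevalleyBasis t X c) {α β : Form t} (hα : α ∈ roots t) (hβ : β ∈ roots t)
    (hne : β ≠ -α) {p q : ℕ} (hs : IsString (roots t) α β p q)
    (hpq : 2 * formInner t β α = ((p : ℝ) - q) * formInner t α α) :
    c α β ^ 2 = q * (1 + p) / 2 * formInner t α α := by
  have h1 := h.isWeylBasis.mul_neg_neg hα hβ hne hs hpq
  rw [h.neg_neg α hα β hβ] at h1
  have h2 : c α β * -c α β = -(q * (1 + p) / 2 * formInner t α α) := by exact_mod_cast h1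
  linarith

/-- The integer `p` of (C5) is defined by membership in `Δ`, whereas strings live in `Δ ∪ {0}`. The
two agree because `ζ + η` is a root: this excludes `η = ±ζ`, so the string does not pass through
zero. -/
theorem valueC5_eq (h : IsChevalleyBasis t X c) {ζ η : Form t} (hζ : ζ ∈ roots t)
    (hη : η ∈ roots t) (hm : ζ + η ∈ roots t) (hpos : 0 < c ζ η) :
    valueC5 (roots t) (formInner t) ζ η = c ζ η := by
  have hne : η ≠ -ζ := by
    rintro rfl
    exact hm.1 (add_neg_cancel ζ)
  have hne' : η ≠ ζ := by
    rintro rfl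
    exact add_self_notMem_roots hη hm
  obtain ⟨p, q, hs, hpq⟩ := exists_isString hζ hη
  have hip := formInner_self_pos (isImaginary_of_mem_roots hζ) hζ.1
  have hp : stringP (roots t) ζ η = p := by
    have hcast : ∀ k : ℕ, η - (k + 1) • ζ = η + (-((k : ℤ) + 1)) • ζ := by
      intro k
      module
    refine le_antisymm (Nat.sInf_le ?_) (le_csInf ⟨p, ?_⟩ ?_)
    iterate 2
      intro hmem
      rw [hcast] at hmem
      have := (hs _).1 (Or.inl hmem)
      omega
    · intro k hk
      by_contra hlt
      have h1 := (hs (-((k : ℤ) + 1))).2 ⟨by omega, by omega⟩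
      rw [← hcast] at h1
      rcases h1 with h1 | h1
      · exact hk h1
      · have h2 : η = ((k + 1 : ℕ) : ℂ) • ζ := by
          rw [Nat.cast_smul_eq_nsmul]
          exact sub_eq_zero.1 h1
        exact (eq_or_eq_neg_of_eq_smul hζ hη _ h2).elim hne hne'
  have hq : (p : ℝ) - 2 * (formInner t η ζ / formInner t ζ ζ) = q := by
    field_simp
    linarith
  unfold valueC5
  simp only [hp, hq]
  rw [← Real.sqrt_mul (by positivity), ← h.sq_eq hζ hη hne hs hpq, Real.sqrt_sq hpos.le]

end IsChevalleyBasis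

end WeylBases

end ChevalleyBasis

/-! ### Reality of the constants -/

namespace ChevalleyBasis

namespace IsStructureTable
variable {V : Type*} [AddCommGroup V] {Δ P : Set V}

/-- The constants `N x (-y)` are real if the constants of the decompositions of `x` and `y` are. -/
theorem conj_mixed {N : V → V → ℂ} (hP : IsPositiveSystem Δ P) (hN : IsStructureTable Δ N)
    (hconj : ∀ α ∈ Δ, ∀ β ∈ Δ, β ≠ -α → N (-α) (-β) = -(starRingEnd ℂ) (N α β)) {x y : V}
    (hx : x ∈ P) (hy : y ∈ P) (hxy : x ≠ y)
    (hxr : ∀ γ ∈ P, ∀ δ ∈ P, γ + δ = x → (starRingEnd ℂ) (N γ δ) = N γ δ)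
    (hyr : ∀ γ ∈ P, ∀ δ ∈ P, γ + δ = y → (starRingEnd ℂ) (N γ δ) = N γ δ) :
    (starRingEnd ℂ) (N x (-y)) = N x (-y) := by
  have hs := hP.subset
  by_cases h1 : y - x ∈ P
  · rw [← hN.cyclic (y - x) (hs h1) x (hs hx) (-y) (hP.neg_mem _ (hs hy)) (by abel)]
    exact hyr _ h1 _ hx (by abel)
  by_cases h2 : x - y ∈ P
  · rw [hN.cyclic x (hs hx) (-y) (hP.neg_mem _ (hs hy)) (-(x - y)) (hP.neg_mem _ (hs h2)) (by abel),
      hconj y (hs hy) _ (hs h2) (hP.ne_neg h2 hy), map_neg, hxr y hy _ h2 (by abel)]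
    rw [hxr y hy _ h2 (by abel)]
  · rw [hN.eq_zero x (hs hx) _ (hP.neg_mem _ (hs hy)) (hP.sub_notMem_of_notMem h2 h1)
      fun h => hxy (neg_injective h).symm, map_zero]

/-- If the constants of one decomposition of every positive root are positive, then all constants
are real. -/
theorem conj_eq_of_decomposition {N : V → V → ℂ} (hP : IsPositiveSystem Δ P)
    (hN : IsStructureTable Δ N)
    (hconj : ∀ α ∈ Δ, ∀ β ∈ Δ, β ≠ -α → N (-α) (-β) = -(starRingEnd ℂ) (N α β))
    {lev : V → ℕ} (hl : IsLevel P lev) {ζ η : V → V} (hζη : IsDecomposition P ζ η)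
    (hpos : ∀ α ∈ P \ simpleRoots P, ∃ r : ℝ, 0 < r ∧ N (ζ α) (η α) = r) :
    ∀ α ∈ Δ, ∀ β ∈ Δ, β ≠ -α → (starRingEnd ℂ) (N α β) = N α β := by
  have hs := hP.subset
  -- Induction on the level: the recursion of (C7) writes `N γ δ` as a rational expression in
  -- constants that are real by induction and in the positive number `N (ζ α) (η α)`.
  have main : ∀ n : ℕ, ∀ α ∈ P, lev α = n →
      ∀ γ ∈ P, ∀ δ ∈ P, γ + δ = α → (starRingEnd ℂ) (N γ δ) = N γ δ := by
    intro n
    induction n using Nat.strong_induction_on with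
    | _ n ih =>
      intro α hα hn γ hγ δ hδ hsum
      have hns : α ∈ P \ simpleRoots P := ⟨hα, fun h => h.2 ⟨γ, hγ, δ, hδ, hsum.symm⟩⟩
      obtain ⟨hζ, hη, hαζη⟩ := hζη α hns
      obtain ⟨r, hr, hNr⟩ := hpos α hns
      have hlow : ∀ x ∈ P, ∀ y ∈ P, x + y = α → lev x < n := by
        rintro x hx y hy rfl
        rw [← hn, hl.map_add x hx y hy hα]
        have := hl.one_le y hy
        omega
      have hreal : ∀ x ∈ P, lev x < n → ∀ γ ∈ P, ∀ δ ∈ P, γ + δ = x →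
          (starRingEnd ℂ) (N γ δ) = N γ δ := fun x hx hlt => ih _ hlt x hx rfl
      have hγl := hreal γ hγ (hlow γ hγ δ hδ hsum)
      have hδl := hreal δ hδ (hlow δ hδ γ hγ (by rw [add_comm, hsum]))
      have hζl := hreal _ hζ (hlow _ hζ _ hη hαζη.symm)
      have hηl := hreal _ hη (hlow _ hη _ hζ (by rw [add_comm, ← hαζη]))
      have hζηr : (starRingEnd ℂ) (N (ζ α) (η α)) = N (ζ α) (η α) := by
        rw [hNr, Complex.conj_ofReal]
      have hskew := hN.skew _ (hs hζ) _ (hs hη) (hP.ne_neg hη hζ)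
      have hηζr : (starRingEnd ℂ) (N (η α) (ζ α)) = N (η α) (ζ α) := by
        rw [hskew, map_neg, hζηr]
      have hsum' := hsum.trans hαζη
      by_cases h1 : γ = ζ α
      · rw [h1] at hsum' ⊢
        rwa [add_left_cancel hsum']
      by_cases h2 : γ = η α
      · rw [h2, add_comm (ζ α)] at hsum'
        rw [h2, add_left_cancel hsum']
        exact hηζr
      have h3 : δ ≠ ζ α := by
        intro h
        rw [h, add_comm] at hsum'
        exact h2 (add_left_cancel hsum')
      have h4 : δ ≠ η α := by
        intro h
        rw [h] at hsum'
        exact h1 (add_right_cancel hsum')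
      have h5 := four_of_add_eq hP hN hγ hδ hζ hη hsum' h1 h2 h3 h4
      rw [hconj _ (hs hζ) _ (hs hη) (hP.ne_neg hη hζ), hζηr,
        hN.skew γ (hs hγ) (-ζ α) (hP.neg_mem _ (hs hζ))
          (fun h => h1 (neg_injective h).symm)] at h5
      have e1 := conj_mixed hP hN hconj hδ hζ h3 hδl hζl
      have e2 := conj_mixed hP hN hconj hγ hη h2 hγl hηl
      have e3 := conj_mixed hP hN hconj hγ hζ h1 hγl hζl
      have e4 := conj_mixed hP hN hconj hδ hη h4 hδl hηl
      have hne : N (ζ α) (η α) ≠ 0 := by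
        rw [hNr]
        exact_mod_cast hr.ne'
      have h6 : N γ δ = (N δ (-ζ α) * N γ (-η α) - N γ (-ζ α) * N δ (-η α)) / N (ζ α) (η α) := by
        field_simp
        linear_combination -h5
      rw [h6, map_div₀, map_sub, map_mul, map_mul, e1, e2, e3, e4, hζηr]
  have main' : ∀ x, ∀ γ ∈ P, ∀ δ ∈ P, γ + δ = x → (starRingEnd ℂ) (N γ δ) = N γ δ := by
    rintro x γ hγ δ hδ rfl
    by_cases h : γ + δ ∈ P
    · exact main _ _ h rfl γ hγ δ hδ rfl
    · rw [hN.eq_zero γ (hs hγ) δ (hs hδ) (fun h' => h (hP.add_mem γ hγ δ hδ h'))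
        (hP.ne_neg hδ hγ), map_zero]
  intro α hα β hβ hne
  rcases hP.mem_or α hα with h1 | h1 <;> rcases hP.mem_or β hβ with h2 | h2
  · exact main' _ α h1 β h2 rfl
  · have := conj_mixed hP hN hconj h1 h2 (fun h => hne (by rw [h, _root_.neg_neg])) (main' _)
      (main' _)
    rwa [_root_.neg_neg] at this
  · have := conj_mixed hP hN hconj h2 h1 hne (main' _) (main' _)
    rw [_root_.neg_neg] at this
    rw [hN.skew β hβ α hα fun h => hne (by rw [h, _root_.neg_neg]), map_neg, this]
  · have := hconj _ (hP.neg_mem _ hα) _ (hP.neg_mem _ hβ)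
      fun h => hne (neg_injective h)
    rw [_root_.neg_neg, _root_.neg_neg, main' _ _ h1 _ h2 rfl] at this
    rw [this, map_neg, main' _ _ h1 _ h2 rfl]

end IsStructureTable

/-! ### Existence of adapted Chevalley bases -/

section Existence
variable {g : Type*} [LieRing g] [LieAlgebra ℝ g] [Module.Finite ℝ g] [IsCompactLieAlgebra g]
  {t : LieSubalgebra ℝ g}

theorem exists_unit_rootVector {α : Form t} (hα : α ∈ roots t) :
    ∃ Y ∈ rootSpace t α,
      killingForm ℂ (Complexification g) Y (Complexification.conj g Y) = -1 := by
  obtain ⟨X, hX, h0⟩ := exists_mem_rootSpace hα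
  obtain ⟨r, hr, h⟩ := Complexification.exists_killingForm_conj X h0
  refine ⟨((1 / Real.sqrt r : ℝ) : ℂ) • X, (rootSpace t α).smul_mem _ hX, ?_⟩
  rw [Complexification.conj_smul, Complex.conj_ofReal, map_smul, map_smul, LinearMap.smul_apply, h,
    smul_eq_mul, smul_eq_mul, ← mul_assoc, ← Complex.ofReal_mul, div_mul_div_comm, one_mul,
    Real.mul_self_sqrt hr.le, mul_neg, ← Complex.ofReal_mul, one_div_mul_cancel hr.ne',
    Complex.ofReal_one]

variable [hH : (complexify t).IsCartanSubalgebra]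

/-- Unit root vectors for the positive roots extend to a Weyl basis compatible with the
conjugation. -/
theorem exists_isWeylBasis {P : Set (Form t)} (hP : IsPositiveSystem (roots t) P)
    {Y : Form t → Complexification g} (hY : ∀ α ∈ P, Y α ∈ rootSpace t α ∧
      killingForm ℂ (Complexification g) (Y α) (Complexification.conj g (Y α)) = -1) :
    ∃ X N, IsWeylBasis t X N ∧ (∀ α ∈ P, X α = Y α) ∧
      (∀ α ∈ P, X (-α) = -Complexification.conj g (X α)) ∧
      ∀ α ∈ roots t, ∀ β ∈ roots t, β ≠ -α → N (-α) (-β) = -(starRingEnd ℂ) (N α β) := by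
  classical
  let X : Form t → Complexification g :=
    fun α => if α ∈ P then Y α else -Complexification.conj g (Y (-α))
  have hXP : ∀ α ∈ P, X α = Y α := fun α hα => if_pos hα
  have hXN : ∀ α ∈ P, X (-α) = -Complexification.conj g (Y α) := fun α hα => by
    change (if -α ∈ P then Y (-α) else -Complexification.conj g (Y (-(-α)))) = _
    rw [if_neg (hP.neg_notMem α hα), neg_neg]
  have hconjX : ∀ α ∈ roots t, X (-α) = -Complexification.conj g (X α) := by
    intro α hα
    rcases hP.mem_or α hα with h | h
    · rw [hXN α h, hXP α h]
    · have h' := hXN _ h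
      rw [neg_neg] at h'
      rw [hXP _ h, h', map_neg, Complexification.conj_conj, neg_neg]
  have hmem : ∀ α ∈ roots t, X α ∈ rootSpace t α := by
    intro α hα
    rcases hP.mem_or α hα with h | h
    · rw [hXP α h]
      exact (hY α h).1
    · have h' := hXN _ h
      rw [neg_neg] at h'
      rw [h']
      have := conj_mem_rootSpace (isImaginary_of_mem_roots (hP.subset h)) (hY _ h).1
      rw [neg_neg] at this
      exact (rootSpace t α).neg_mem this
  -- The bracket is `κ(X α, X (-α)) α♯`, and the coefficient is `-κ(Y α, conj (Y α)) = 1`.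
  have hlieP : ∀ α ∈ P, ⁅X α, X (-α)⁆ = (sharp t α : Complexification g) := by
    intro α hα
    have hα' := hP.subset hα
    rw [lie_eq_smul_sharp hα' (hmem α hα') (hmem _ (neg_mem_roots hα')), hXN α hα, hXP α hα,
      map_neg, (hY α hα).2, neg_neg, one_smul]
  have hlie : ∀ α ∈ roots t, ⁅X α, X (-α)⁆ = (sharp t α : Complexification g) := by
    intro α hα
    rcases hP.mem_or α hα with h | h
    · exact hlieP α h
    · have h' := hlieP _ h
      rw [neg_neg, map_neg] at h'
      rw [← lie_skew, h', NegMemClass.coe_neg, neg_neg]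
  have hX0 : ∀ α ∈ roots t, X α ≠ 0 := by
    intro α hα h0
    have h1 := hlie α hα
    rw [h0, zero_lie] at h1
    exact hα.1 ((sharp t).injective (Subtype.ext (by rw [← h1, map_zero]; rfl)))
  have hN : ∀ α β : Form t, ∃ n : ℂ, (α ∈ roots t → β ∈ roots t → α + β ∈ roots t →
      ⁅X α, X β⁆ = n • X (α + β)) ∧ (α + β ∉ roots t → n = 0) := by
    intro α β
    by_cases h : α ∈ roots t ∧ β ∈ roots t ∧ α + β ∈ roots t
    · obtain ⟨n, hn⟩ := exists_eq_smul h.2.2 (hmem _ h.2.2) (hX0 _ h.2.2)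
        (lie_mem_rootSpace (hmem α h.1) (hmem β h.2.1))
      exact ⟨n, fun _ _ _ => hn, fun h' => absurd h.2.2 h'⟩
    · exact ⟨0, fun h1 h2 h3 => absurd ⟨h1, h2, h3⟩ h, fun _ => rfl⟩
  choose N hN1 hN2 using hN
  refine ⟨X, N, ⟨hmem, fun α hα β hβ => hN1 α β hα hβ, hlie, fun α _ β _ h _ => hN2 α β h⟩, hXP,
    fun α hα => hconjX α (hP.subset hα), ?_⟩
  intro α hα β hβ _
  by_cases h : α + β ∈ roots t
  · have hneg : -α + -β = -(α + β) := by abel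
    have h1 := hN1 (-α) (-β) (neg_mem_roots hα) (neg_mem_roots hβ) (hneg ▸ neg_mem_roots h)
    rw [hneg, hconjX α hα, hconjX β hβ, hconjX _ h, neg_lie, lie_neg, neg_neg,
      ← Complexification.conj_lie, hN1 α β hα hβ h, Complexification.conj_smul, smul_neg,
      ← neg_smul] at h1
    have h2 : Complexification.conj g (X (α + β)) ≠ 0 := by
      intro h0
      apply hX0 _ h
      rw [← Complexification.conj_conj (X (α + β)), h0, map_zero]
    have h3 := smul_left_injective ℂ h2 h1
    rw [h3, neg_neg]
  · have h' : -α + -β ∉ roots t := by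
      intro h'
      have := neg_mem_roots h'
      rw [neg_add, neg_neg, neg_neg] at this
      exact h this
    rw [hN2 _ _ h, hN2 _ _ h', map_zero, neg_zero]

/-- The phases of the positive root vectors can be chosen so that the constants of the fixed
decompositions are positive. -/
theorem exists_unit_rootVectors {P : Set (Form t)} (hP : IsPositiveSystem (roots t) P)
    {lev : Form t → ℕ} (hl : IsLevel P lev) {ζ η : Form t → Form t} (hζη : IsDecomposition P ζ η)
    (n : ℕ) :
    ∃ Y : Form t → Complexification g, (∀ α ∈ P, Y α ∈ rootSpace t α ∧
      killingForm ℂ (Complexification g) (Y α) (Complexification.conj g (Y α)) = -1) ∧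
      ∀ α ∈ P \ simpleRoots P, lev α ≤ n →
        ∃ r : ℝ, 0 < r ∧ ⁅Y (ζ α), Y (η α)⁆ = (r : ℂ) • Y α := by
  classical
  induction n with
  | zero =>
    have hex : ∀ α : Form t, ∃ Y : Complexification g, α ∈ P → Y ∈ rootSpace t α ∧
        killingForm ℂ (Complexification g) Y (Complexification.conj g Y) = -1 := by
      intro α
      by_cases h : α ∈ P
      · obtain ⟨Y, hY⟩ := exists_unit_rootVector (hP.subset h)
        exact ⟨Y, fun _ => hY⟩
      · exact ⟨0, fun h' => absurd h' h⟩
    choose Y hY using hex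
    refine ⟨Y, hY, fun α hα h => ?_⟩
    have := hl.one_le α hα.1
    omega
  | succ n ih =>
    obtain ⟨Y, hY, hYn⟩ := ih
    obtain ⟨X, N, hW, hXY, -, -⟩ := exists_isWeylBasis hP hY
    -- Multiplying `Y α` by the phase of `N (ζ α) (η α)` replaces this constant by its absolute
    -- value. Only level `n + 1` is changed, so `Y (ζ α)`, `Y (η α)` and the constants achieved for
    -- lower levels stay as they are.
    let u : Form t → ℂ := fun α =>
      if α ∈ P \ simpleRoots P ∧ lev α = n + 1 then N (ζ α) (η α) / ‖N (ζ α) (η α)‖ else 1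
    have hN0 : ∀ α ∈ P \ simpleRoots P, N (ζ α) (η α) ≠ 0 := by
      intro α hα
      obtain ⟨h1, h2, h3⟩ := hζη α hα
      exact hW.ne_zero_of_add_mem (hP.subset h1) (hP.subset h2) (h3 ▸ hP.subset hα.1)
    have hu : ∀ α, u α * (starRingEnd ℂ) (u α) = 1 := by
      intro α
      by_cases h : α ∈ P \ simpleRoots P ∧ lev α = n + 1
      · rw [show u α = N (ζ α) (η α) / ‖N (ζ α) (η α)‖ from if_pos h, Complex.mul_conj,
          Complex.normSq_eq_norm_sq, norm_div, Complex.norm_real, norm_norm,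
          div_self (norm_ne_zero_iff.2 (hN0 α h.1))]
        norm_num
      · rw [show u α = 1 from if_neg h, map_one, one_mul]
    have hu1 : ∀ α, lev α ≤ n → u α = 1 := fun α h => if_neg fun h' => by omega
    refine ⟨fun α => u α • Y α, fun α hα => ⟨(rootSpace t α).smul_mem _ (hY α hα).1, ?_⟩, ?_⟩
    · rw [Complexification.conj_smul, map_smul, map_smul, LinearMap.smul_apply, (hY α hα).2,
        smul_eq_mul, smul_eq_mul, ← mul_assoc, mul_comm (starRingEnd ℂ _), hu, one_mul]
    · intro α hα hlev
      obtain ⟨h1, h2, h3⟩ := hζη α hα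
      have h4 := hl.map_add _ h1 _ h2 (h3 ▸ hα.1)
      rw [← h3] at h4
      have h5 := hl.one_le _ h1
      have h6 := hl.one_le _ h2
      simp only [hu1 (ζ α) (by omega), hu1 (η α) (by omega), one_smul]
      rcases Nat.lt_succ_iff_lt_or_eq.1 (Nat.lt_succ_of_le hlev) with h7 | h7
      · rw [hu1 α (by omega), one_smul]
        exact hYn α hα (by omega)
      · refine ⟨‖N (ζ α) (η α)‖, norm_pos_iff.2 (hN0 α hα), ?_⟩
        have h8 : (‖N (ζ α) (η α)‖ : ℂ) ≠ 0 := by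
          exact_mod_cast norm_ne_zero_iff.2 (hN0 α hα)
        rw [show u α = N (ζ α) (η α) / ‖N (ζ α) (η α)‖ from if_pos ⟨hα, h7⟩, smul_smul,
          mul_div_cancel₀ _ h8, ← hXY _ h1, ← hXY _ h2, ← hXY _ hα.1,
          hW.lie_of_add_mem _ (hP.subset h1) _ (hP.subset h2) (h3 ▸ hP.subset hα.1), ← h3]

theorem exists_isAdapted {H₀ : t} (hP : IsPositiveSystem (roots t) (posRoots t H₀))
    {lev : Form t → ℕ} (hl : IsLevel (posRoots t H₀) lev) {ζ η : Form t → Form t}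
    (hζη : IsDecomposition (posRoots t H₀) ζ η) : ∃ X c, IsAdapted t H₀ ζ η X c := by
  classical
  obtain ⟨Y, hY, hYpos⟩ := exists_unit_rootVectors hP hl hζη (maxLevel (posRoots t H₀))
  obtain ⟨X, N, hW, hXY, hX, hconj⟩ := exists_isWeylBasis hP hY
  have hpos : ∀ α ∈ posRoots t H₀ \ simpleRoots (posRoots t H₀),
      ∃ r : ℝ, 0 < r ∧ N (ζ α) (η α) = r := by
    intro α hα
    obtain ⟨h1, h2, h3⟩ := hζη α hα
    obtain ⟨r, hr, h⟩ := hYpos α hα (hl.le_maxLevel α hα.1)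
    refine ⟨r, hr, ?_⟩
    rw [← hXY _ h1, ← hXY _ h2, ← hXY _ hα.1,
      hW.lie_of_add_mem _ (hP.subset h1) _ (hP.subset h2) (h3 ▸ hP.subset hα.1), ← h3] at h
    exact smul_left_injective ℂ (hW.ne_zero (hP.subset hα.1)) h
  have hreal := hW.isStructureTable.conj_eq_of_decomposition hP hconj hl hζη hpos
  have hne : ∀ α β : Form t, α + β ∈ roots t → β ≠ -α := by
    rintro α β h rfl
    exact h.1 (add_neg_cancel α)
  -- The value zero when `α + β` is not a root covers `c α (-α)` too, where antisymmetry under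
  -- negation is also demanded.
  let c : Form t → Form t → ℝ := fun α β => if α + β ∈ roots t then (N α β).re else 0
  have hc : ∀ α β, α + β ∈ roots t → c α β = (N α β).re := fun α β h => if_pos h
  refine ⟨X, c, ⟨⟨hW.mem_rootSpace, ?_, ?_, ?_, ?_, ?_⟩, hX, ?_⟩⟩
  · intro α hα β hβ h
    rw [hc α β h, Complex.conj_eq_iff_re.1 (hreal α hα β hβ (hne α β h)),
      hW.lie_of_add_mem α hα β hβ h]
  · intro α hα β hβ h
    rw [eq_neg_of_add_eq_zero_right h, hW.lie_neg α hα]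
  · intro α hα β hβ h h0
    have h' : β ≠ -α := fun h1 => h0 (by rw [h1, add_neg_cancel])
    rw [hW.lie_eq hα hβ h', hW.eq_zero α hα β hβ h h', zero_smul]
  · intro α hα β hβ
    have hiff : -α + -β ∈ roots t ↔ α + β ∈ roots t := by
      rw [← neg_add]
      refine ⟨fun h => ?_, neg_mem_roots⟩
      have := neg_mem_roots h
      rwa [neg_neg] at this
    by_cases h : α + β ∈ roots t
    · rw [hc α β h, hc _ _ (hiff.2 h), hconj α hα β hβ (hne α β h), Complex.neg_re,
        Complex.conj_re]
    · have h' : -α + -β ∉ roots t := fun h' => h (hiff.1 h')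
      rw [show c α β = 0 from if_neg h, show c (-α) (-β) = 0 from if_neg h', neg_zero]
  · exact fun α _ β _ h _ => if_neg h
  · intro α hα
    obtain ⟨-, -, h3⟩ := hζη α hα
    obtain ⟨r, hr, h⟩ := hpos α hα
    rw [hc _ _ (h3 ▸ hP.subset hα.1), h]
    exact hr

end Existence

/-! ### Correctness for adapted Chevalley bases -/

section Correctness
variable {g : Type*} [LieRing g] [LieAlgebra ℝ g] [Module.Finite ℝ g] [IsCompactLieAlgebra g]
  {t : LieSubalgebra ℝ g} [hH : (complexify t).IsCartanSubalgebra]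

namespace IsAdapted
variable {H₀ : t} {ζ η : Form t → Form t} {X : Form t → Complexification g}
  {c : Form t → Form t → ℝ} {lev : Form t → ℕ}

theorem runUpTo_agreesOn (h : IsAdapted t H₀ ζ η X c)
    (hP : IsPositiveSystem (roots t) (posRoots t H₀)) (hl : IsLevel (posRoots t H₀) lev)
    (hζη : IsDecomposition (posRoots t H₀) ζ η) (o : LoopOrder (posRoots t H₀) ζ η)
    (c₀ : Form t → Form t → ℝ) (n : ℕ) :
    AgreesOn (posRoots t H₀) c {α | α ∈ posRoots t H₀ → lev α ≤ n}
      (runUpTo (roots t) (posRoots t H₀) (formInner t) ζ η o c₀ n) := by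
  refine h.toIsChevalleyBasis.isStructureTable.runUpTo_agreesOn hP h.neg_neg hζη ?_
    (fun α hα => (h.pos α hα).ne') hl o c₀ n
  intro α hα
  obtain ⟨h1, h2, h3⟩ := hζη α hα
  exact h.toIsChevalleyBasis.valueC5_eq (hP.subset h1) (hP.subset h2) (h3 ▸ hP.subset hα.1)
    (h.pos α hα)

theorem extendTable_algorithmC (h : IsAdapted t H₀ ζ η X c)
    (hP : IsPositiveSystem (roots t) (posRoots t H₀)) (hl : IsLevel (posRoots t H₀) lev)
    (hζη : IsDecomposition (posRoots t H₀) ζ η) (o : LoopOrder (posRoots t H₀) ζ η)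
    (c₀ : Form t → Form t → ℝ) :
    ∀ α ∈ roots t, ∀ β ∈ roots t, β ≠ -α →
      extendTable (posRoots t H₀)
        (algorithmC (roots t) (posRoots t H₀) (formInner t) ζ η o c₀) α β = c α β :=
  h.toIsChevalleyBasis.isStructureTable.extendTable_eq hP h.neg_neg fun α hα β hβ =>
    h.runUpTo_agreesOn hP hl hζη o c₀ _ α hα β hβ fun hm => hl.le_maxLevel _ hm

end IsAdapted

end Correctness

end ChevalleyBasis
end

theorem mainTheorem2 {g : Type*} [LieRing g] [LieAlgebra ℝ g] [Module.Finite ℝ g]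
    [IsCompactLieAlgebra g]
    (t : LieSubalgebra ℝ g) (ht : Maximal (fun s : LieSubalgebra ℝ g => IsLieAbelian s) t)
    (H₀ : t) (hH₀ : ∀ α ∈ ChevalleyBasis.roots t, α (ChevalleyBasis.incl t H₀) ≠ 0)
    (ζ η : ChevalleyBasis.Form t → ChevalleyBasis.Form t)
    (hζη : ChevalleyBasis.IsDecomposition (ChevalleyBasis.posRoots t H₀) ζ η) :
    -- existence of an adapted Chevalley basis
    (∃ (X : ChevalleyBasis.Form t → Complexification g)
      (c : ChevalleyBasis.Form t → ChevalleyBasis.Form t → ℝ),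
      ChevalleyBasis.IsAdapted t H₀ ζ η X c) ∧
    -- any two adapted Chevalley bases have the same Chevalley constants
    (∀ (X X' : ChevalleyBasis.Form t → Complexification g)
      (c c' : ChevalleyBasis.Form t → ChevalleyBasis.Form t → ℝ),
      ChevalleyBasis.IsAdapted t H₀ ζ η X c → ChevalleyBasis.IsAdapted t H₀ ζ η X' c' →
      ∀ α ∈ ChevalleyBasis.roots t, ∀ β ∈ ChevalleyBasis.roots t, β ≠ -α → c α β = c' α β) ∧
    -- the formula for the squares and the four-root relation
    (∀ (X : ChevalleyBasis.Form t → Complexification g)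
      (c : ChevalleyBasis.Form t → ChevalleyBasis.Form t → ℝ),
      ChevalleyBasis.IsChevalleyBasis t X c →
      (∀ α ∈ ChevalleyBasis.roots t, ∀ β ∈ ChevalleyBasis.roots t, β ≠ -α →
        ∃ p q : ℕ, ChevalleyBasis.IsString (ChevalleyBasis.roots t) α β p q ∧
          c α β ^ 2 = (q : ℝ) * (1 + p) / 2 * ChevalleyBasis.formInner t α α) ∧
      (∀ α ∈ ChevalleyBasis.roots t, ∀ β ∈ ChevalleyBasis.roots t,
        ∀ γ ∈ ChevalleyBasis.roots t, ∀ δ ∈ ChevalleyBasis.roots t, α + β + γ + δ = 0 →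
        α ≠ -β → α ≠ -γ → α ≠ -δ → β ≠ -γ → β ≠ -δ → γ ≠ -δ →
        c α β * c γ δ + c β γ * c α δ + c γ α * c β δ = 0)) ∧
    -- the loops of Algorithm (C) can be run through, and in whatever order this is done, the
    -- algorithm computes the Chevalley constants level by level
    Nonempty (ChevalleyBasis.LoopOrder (ChevalleyBasis.posRoots t H₀) ζ η) ∧
    (∀ (o : ChevalleyBasis.LoopOrder (ChevalleyBasis.posRoots t H₀) ζ η)
      (c₀ : ChevalleyBasis.Form t → ChevalleyBasis.Form t → ℝ)
      (X : ChevalleyBasis.Form t → Complexification g)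
      (c : ChevalleyBasis.Form t → ChevalleyBasis.Form t → ℝ),
      ChevalleyBasis.IsAdapted t H₀ ζ η X c →
      (∀ n m : ℕ, m ≤ n → n ≤ ChevalleyBasis.maxLevel (ChevalleyBasis.posRoots t H₀) →
        ∀ α ∈ ChevalleyBasis.posRoots t H₀, ∀ β ∈ ChevalleyBasis.posRoots t H₀,
        α + β ∈ ChevalleyBasis.posRoots t H₀ →
        ChevalleyBasis.HasLevel (ChevalleyBasis.posRoots t H₀) (α + β) m →
        ChevalleyBasis.runUpTo (ChevalleyBasis.roots t) (ChevalleyBasis.posRoots t H₀)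
          (ChevalleyBasis.formInner t) ζ η o c₀ n α β = c α β) ∧
      (∀ α ∈ ChevalleyBasis.roots t, ∀ β ∈ ChevalleyBasis.roots t, β ≠ -α →
        ChevalleyBasis.extendTable (ChevalleyBasis.posRoots t H₀)
          (ChevalleyBasis.algorithmC (ChevalleyBasis.roots t) (ChevalleyBasis.posRoots t H₀)
            (ChevalleyBasis.formInner t) ζ η o c₀) α β = c α β)) := by
  have hH := ChevalleyBasis.isCartanSubalgebra_complexify ht
  have hP := ChevalleyBasis.isPositiveSystem_posRoots hH₀
  obtain ⟨lev, hl⟩ := ChevalleyBasis.exists_isLevel hP.finite (ChevalleyBasis.height H₀)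
    (fun α => ChevalleyBasis.height_pos) (ChevalleyBasis.linearIndepOn_simpleRoots hH₀)
  have hord := ChevalleyBasis.nonempty_loopOrder hP.finite ζ η
  refine ⟨ChevalleyBasis.exists_isAdapted hP hl hζη, ?_, ?_, hord, ?_⟩
  · intro X X' c c' h h' α hα β hβ hne
    obtain ⟨o⟩ := hord
    -- Both families of constants are the output of one and the same run; the initial table `c` is
    -- an arbitrary choice.
    rw [← h.extendTable_algorithmC hP hl hζη o c α hα β hβ hne,
      h'.extendTable_algorithmC hP hl hζη o c α hα β hβ hne]
  · intro X c h
    refine ⟨fun α hα β hβ hne => ?_, h.isStructureTable.four⟩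
    obtain ⟨p, q, hs, hpq⟩ := ChevalleyBasis.exists_isString hα hβ
    exact ⟨p, q, hs, h.sq_eq hα hβ hne hs hpq⟩
  · intro o c₀ X c h
    refine ⟨fun n m hmn _ α hα β hβ hm hlev => ?_, h.extendTable_algorithmC hP hl hζη o c₀⟩
    refine h.runUpTo_agreesOn hP hl hζη o c₀ n α hα β hβ fun _ => ?_
    have : (m : ℤ) = lev (α + β) := (hl.hasLevel_iff _ hm _).1 hlev
    omega
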